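/- Let $\mathbb D$ be the open unit disc of $\mathbb C$ and $dA=\frac{dx\,dy}{\pi}$. A radial weight is a nonnegative function $\omega\in L^1([0,1))$ with $\widehat\omega(r)=\int_r^1\omega(s)\,ds>0$ for all $0\le r<1$; one writes $\omega(z)=\omega(|z|)$ and $\widehat\omega(z)=\widehat\omega(|z|)$ for $z\in\mathbb D$. A radial weight $\omega$ belongs to $\widehat{\mathcal D}$ if there is $C>0$ such that $\widehat\omega(r)\le C\,\widehat\omega\left(\frac{1+r}{2}\right)$ for all $r<1$ sufficiently close to $1$, and it belongs to $\check{\mathcal D}$ if there are $K>1$ and $C>1$ such that $\widehat\omega(r)\ge C\,\widehat\omega\left(1-\frac{1-r}{K}\right)$ for all $r<1$ sufficiently close to $1$. For a radial weight $\omega$ let $A^2_\omega$ be the space of analytic functions $f$ on $\mathbb D$ with $\int_{\mathbb D}|f|^2\omega\,dA<\infty$, let $B^\omega_z$ ($z\in\mathbb D$) be its reproducing kernels, so that $f(z)=\int_{\mathbb D}f\,\overline{B^\omega_z}\,\omega\,dA$ for all $f\in A^2_\omega$, and let $$P_\omega f(z)=\int_{\mathbb D} f(\zeta)\,\overline{B^\omega_z(\zeta)}\,\omega(\zeta)\,dA(\zeta),\qquad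 z\in\mathbb D,$$ be the Bergman projection induced by $\omega$. For a radial weight $\nu$ let $L^\infty_{\widehat\nu}$ be the space of measurable $f:\mathbb D\to\mathbb C$ with $\|f\|_{\infty,\widehat\nu}=\operatorname{ess\,sup}_{z\in\mathbb D}|f(z)|\,\widehat\nu(z)<\infty$, and let $H^\infty_{\widehat\nu}$ be the space of analytic functions in $L^\infty_{\widehat\nu}$. That $P_\omega:L^\infty_{\widehat\nu}\to H^\infty_{\widehat\nu}$ is bounded means that, for every $f\in L^\infty_{\widehat\nu}$, the integral defining $P_\omega f(z)$ converges absolutely for every $z\in\mathbb D$ and $P_\omega f\in H^\infty_{\widehat\nu}$, and that there is a constant $C<\infty$ with $\|P_\omega f\|_{\infty,\widehat\nu}\le C\|f\|_{\infty,\widehat\nu}$ for all $f\in L^\infty_{\widehat\nu}$. **Theorem.** Let $\nu\in\widehat{\mathcal D}$. Then there is a radial weight $\omega$ such that $P_\omega:L^\infty_{\widehat\nu}\to H^\infty_{\widehat\nu}$ is bounded if and only if $\nu\in\check{\mathcal D}$. In particular, if $\nu\in\widehat{\mathcal D}\setminus\check{\mathcal D}$, then for every radial weight $\omega$ the projection $P_\omega$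 is not bounded from $L^\infty_{\widehat\nu}$ to $H^\infty_{\widehat\nu}$. -/

import Mathlib

open Set Filter Topology MeasureTheory
open scoped ENNReal NNReal ComplexConjugate

noncomputable section

namespace RadialBergman

/-- The open unit disc of the complex plane. -/
def disc : Set ℂ := Metric.ball 0 1

/-- The normalized area measure `dA = dx dy / π` on the unit disc. -/
def areaMeasure : Measure ℂ := ENNReal.ofReal Real.pi⁻¹ • volume.restrict disc

/-- The tail integral `r ↦ ∫_r^1 ω(s) ds`. -/
def tail (ω : ℝ → ℝ) (r : ℝ) : ℝ := ∫ s in Ico r 1, ω s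

/-- Radial weights: `ω` is a nonnegative function in `L¹([0,1))` all of whose tail integrals are
positive. It is extended to the disc by `ω(z) = ω(|z|)`; only its values on `[0,1)` matter. -/
structure IsRadialWeight (ω : ℝ → ℝ) : Prop where
  nonneg : ∀ r ∈ Ico (0 : ℝ) 1, 0 ≤ ω r
  integrable : IntegrableOn ω (Ico 0 1)
  tail_pos : ∀ r ∈ Ico (0 : ℝ) 1, 0 < tail ω r

/-- The upper doubling condition, defining the class `D̂` among radial weights. -/
def UpperDoubling (ω : ℝ → ℝ) : Prop :=
  ∃ C : ℝ, 0 < C ∧ ∀ᶠ r in 𝓝[<] (1 : ℝ), tail ω r ≤ C * tail ω ((1 + r) / 2)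

/-- The lower doubling condition, defining the class `Ď` among radial weights. -/
def LowerDoubling (ω : ℝ → ℝ) : Prop :=
  ∃ K C : ℝ, 1 < K ∧ 1 < C ∧
    ∀ᶠ r in 𝓝[<] (1 : ℝ), C * tail ω (1 - (1 - r) / K) ≤ tail ω r

/-- Membership in the weighted Bergman space `A²_ω`. -/
def MemBergman (ω : ℝ → ℝ) (f : ℂ → ℂ) : Prop :=
  DifferentiableOn ℂ f disc ∧ Integrable (fun ζ => ‖f ζ‖ ^ 2 * ω ‖ζ‖) areaMeasure

/-- `k` is the reproducing kernel of `A²_ω` at the point `z`: it belongs to `A²_ω` and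
`f(z) = ⟨f, k⟩` for every `f` in `A²_ω`. -/
def IsReproducingKernel (ω : ℝ → ℝ) (z : ℂ) (k : ℂ → ℂ) : Prop :=
  MemBergman ω k ∧
    ∀ f : ℂ → ℂ, MemBergman ω f → f z = ∫ ζ, f ζ * conj (k ζ) * (ω ‖ζ‖ : ℂ) ∂areaMeasure

/-- The reproducing kernel `B_z` of `A²_ω` (for a radial weight `ω` and `z` in the disc it exists,
and it is uniquely determined on the disc, which is all that is ever used). -/
def bergmanKernel (ω : ℝ → ℝ) (z : ℂ) : ℂ → ℂ := Classical.epsilon (IsReproducingKernel ω z)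

/-- The Bergman projection `P_ω f (z) = ∫ f(ζ) conj(B_z(ζ)) ω(ζ) dA(ζ)`. -/
def bergmanProjection (ω : ℝ → ℝ) (f : ℂ → ℂ) (z : ℂ) : ℂ :=
  ∫ ζ, f ζ * conj (bergmanKernel ω z ζ) * (ω ‖ζ‖ : ℂ) ∂areaMeasure

/-- The weighted sup-norm `ess sup_{z ∈ 𝔻} |f(z)| v(|z|)`, with values in `[0,∞]`. -/
def growthNorm (v : ℝ → ℝ) (f : ℂ → ℂ) : ℝ≥0∞ :=
  essSup (fun z => ‖f z‖ₑ * ENNReal.ofReal (v ‖z‖)) areaMeasure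

/-- Membership in the growth space `L^∞_v`. -/
def MemGrowth (v : ℝ → ℝ) (f : ℂ → ℂ) : Prop :=
  AEStronglyMeasurable f areaMeasure ∧ growthNorm v f < ∞

/-- Membership in `H^∞_v`, the analytic functions in `L^∞_v`. -/
def MemAnalyticGrowth (v : ℝ → ℝ) (f : ℂ → ℂ) : Prop :=
  MemGrowth v f ∧ DifferentiableOn ℂ f disc

/-- `P_ω : L^∞_v → H^∞_v` is a well-defined bounded operator: for every `f` in `L^∞_v` the integral
defining `P_ω f` converges absolutely at each point of the disc, `P_ω f` belongs to `H^∞_v`, and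
its norm is at most a fixed multiple of the norm of `f`. -/
def ProjectionBounded (ω v : ℝ → ℝ) : Prop :=
  (∀ f : ℂ → ℂ, MemGrowth v f → ∀ z ∈ disc,
    Integrable (fun ζ => f ζ * conj (bergmanKernel ω z ζ) * (ω ‖ζ‖ : ℂ)) areaMeasure) ∧
  ∃ C : ℝ≥0, ∀ f : ℂ → ℂ, MemGrowth v f →
    MemAnalyticGrowth v (bergmanProjection ω f) ∧
      growthNorm v (bergmanProjection ω f) ≤ C * growthNorm v f

end RadialBergman

end

open Set Filter Topology MeasureTheory
open scoped ENNReal NNReal ComplexConjugate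

noncomputable section

namespace RadialBergman

/-! Write `ν̂` for `tail ν` and `m_n` for `moment ω n`. Orthogonality of monomials gives `B_z(ζ) = ∑
(conj z * ζ)^n / m_n`, so the Taylor coefficients of `P_ω f` are `m_n⁻¹ ∫ f conj(ζ)^n ω dA`
(`hasSum_integral_mul_conj_kernelSeries`).

Necessity: a single test function suffices, `f = arg ζ · e^{-i arg ζ} / ν̂(ζ)`, whose norm is at
most `π`. As in Hardy's inequality, the Fourier coefficients of the sawtooth produce a factor
`1/(n+1)`. At `z = -r` all terms of `i · P_ω f` are nonnegative: they are `(I_n / m_n) r^n / (n+1)`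
with `I_n = ∫ 2 s^{n+1} ω/ν̂`. Upper doubling gives `s^n ν̂(s) ≲ ν̂(1 - 1/(n+1))`, hence `m_n ≲ ν̂(1
- 1/(n+1)) I_n`, and `ω` disappears: `∑ r^n / ((n+1) ν̂(1 - 1/(n+1))) ≲ 1/ν̂(r)`
(`ProjectionBounded.exists_sum_le`). A long block of this sum is a divergent piece of the harmonic
series, which forces `ν̂` to drop by a factor 2 (`lowerDoubling_of_sum_le`).

Sufficiency: take `ω = (1 - s²)^α`, with `α` so large that `(1 - s)^α / ν̂(s)` is almost decreasing,
which upper doubling permits. The kernel is explicit, and the Poisson kernel evaluates its angular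
mean. There remains `∫ (1-s)^α / (ν̂(s) (1-sr)^{α+1}) ds`. The part `s ≤ r` is controlled by lower
doubling through `∫_0^r ds/((1-s) ν̂(s)) ≲ 1/ν̂(r)`, the part `s > r` by the choice of `α`. -/

variable {ω ν : ℝ → ℝ}

/-! ### Area measure and polar coordinates on the disc. -/

theorem measurableSet_disc : MeasurableSet disc := Metric.isOpen_ball.measurableSet

theorem isOpen_disc : IsOpen disc := Metric.isOpen_ball

theorem mem_disc {z : ℂ} : z ∈ disc ↔ ‖z‖ < 1 := by simp [disc]

theorem ofReal_inv_pi_ne_zero : ENNReal.ofReal Real.pi⁻¹ ≠ 0 := by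
  simp [Real.pi_pos]

theorem integrable_areaMeasure_iff {E : Type*} [NormedAddCommGroup E] {F : ℂ → E} :
    Integrable F areaMeasure ↔ IntegrableOn F disc := by
  rw [areaMeasure, integrable_smul_measure ofReal_inv_pi_ne_zero ENNReal.ofReal_ne_top,
    IntegrableOn]

theorem ae_areaMeasure_iff {p : ℂ → Prop} :
    (∀ᵐ z ∂areaMeasure, p z) ↔ ∀ᵐ z, z ∈ disc → p z := by
  rw [areaMeasure, Measure.ae_ennreal_smul_measure_iff ofReal_inv_pi_ne_zero,
    ae_restrict_iff' measurableSet_disc]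

theorem ae_areaMeasure_of_forall {p : ℂ → Prop} (h : ∀ z ∈ disc, p z) :
    ∀ᵐ z ∂areaMeasure, p z :=
  ae_areaMeasure_iff.2 (ae_of_all _ h)

theorem aestronglyMeasurable_areaMeasure_iff {E : Type*} [NormedAddCommGroup E] {F : ℂ → E} :
    AEStronglyMeasurable F areaMeasure ↔ AEStronglyMeasurable F (volume.restrict disc) := by
  constructor
  · intro h
    refine h.mono_ac ?_
    rw [areaMeasure]
    exact Measure.absolutelyContinuous_smul ofReal_inv_pi_ne_zero
  · intro h
    exact h.smul_measure _

instance : IsFiniteMeasure areaMeasure := by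
  have : IsFiniteMeasure (volume.restrict disc) :=
    isFiniteMeasure_restrict.2 (by simp [disc])
  rw [areaMeasure]
  exact Measure.smul_finite _ ENNReal.ofReal_ne_top

theorem integrableOn_polarCoord {F : ℂ → ℂ} (hF : Integrable F) :
    IntegrableOn (fun p : ℝ × ℝ => p.1 • F (Complex.polarCoord.symm p)) polarCoord.target := by
  have h1 : Integrable (fun p : ℝ × ℝ => F (Complex.measurableEquivRealProd.symm p)) :=
    (Complex.volume_preserving_equiv_real_prod.symm).integrable_comp_emb
      Complex.measurableEquivRealProd.symm.measurableEmbedding |>.2 hF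
  have h2 := (integrableOn_image_iff_integrableOn_abs_det_fderiv_smul volume
    polarCoord.open_target.measurableSet
    (fun p _ => (hasFDerivAt_polarCoord_symm p).hasFDerivWithinAt) polarCoord.symm.injOn
    (fun p : ℝ × ℝ => F (Complex.measurableEquivRealProd.symm p))).1 h1.integrableOn
  refine h2.congr_fun (fun p hp => ?_) polarCoord.open_target.measurableSet
  simp only [det_fderivPolarCoordSymm, abs_of_pos (show 0 < p.1 from hp.1)]
  rfl

/-- Integration over the disc in polar coordinates. -/
theorem integral_areaMeasure_polar {F : ℂ → ℂ} (hF : Integrable F areaMeasure) :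
    ∫ ζ, F ζ ∂areaMeasure =
      ∫ s in Ioo (0 : ℝ) 1, (2 * s : ℝ) •
        ((2 * Real.pi)⁻¹ • ∫ θ in (-Real.pi)..Real.pi, F (circleMap 0 s θ)) := by
  have hF' : Integrable (disc.indicator F) :=
    (integrable_indicator_iff measurableSet_disc).2 (integrable_areaMeasure_iff.1 hF)
  have h1 : ∫ ζ, F ζ ∂areaMeasure = Real.pi⁻¹ • ∫ ζ, disc.indicator F ζ := by
    rw [areaMeasure, integral_smul_measure, integral_indicator measurableSet_disc,
      ENNReal.toReal_ofReal (by positivity)]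
  rw [h1, ← Complex.integral_comp_polarCoord_symm,
    show polarCoord.target = Ioi (0 : ℝ) ×ˢ Ioo (-Real.pi) Real.pi from rfl]
  have h2 := setIntegral_prod _ (integrableOn_polarCoord hF')
  rw [Measure.volume_eq_prod, h2,
    setIntegral_eq_of_subset_of_forall_sdiff_eq_zero (s := Ioo (0 : ℝ) 1) measurableSet_Ioi
      Ioo_subset_Ioi_self ?_, ← integral_smul]
  · refine setIntegral_congr_fun measurableSet_Ioo fun s hs => ?_
    simp only
    rw [integral_smul, intervalIntegral.integral_of_le (by linarith [Real.pi_pos]),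
      integral_Ioc_eq_integral_Ioo, smul_smul, smul_smul]
    congr 1
    · field_simp
    · refine setIntegral_congr_fun measurableSet_Ioo fun θ _ => ?_
      have : Complex.polarCoord.symm (s, θ) = circleMap 0 s θ := by
        simp [circleMap, Complex.exp_mul_I]
      simp only [this]
      rw [indicator_of_mem]
      simp [mem_disc, abs_of_pos hs.1, hs.2]
  · intro s hs
    have hs1 : 1 ≤ s := by
      by_contra h
      exact hs.2 ⟨hs.1, not_le.1 h⟩
    refine integral_eq_zero_of_ae (ae_of_all _ fun θ => ?_)
    have : Complex.polarCoord.symm (s, θ) ∉ disc := by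
      rw [mem_disc, Complex.norm_polarCoord_symm]
      simpa using hs1.trans (le_abs_self s)
    simp only [indicator_of_notMem this, smul_zero, Pi.zero_apply]

/-- Periodicity moves the angle from `(-π, π)`, suited to `arg`, to the circle average, suited to
the Cauchy and Poisson formulas. -/
theorem integral_areaMeasure_circleAverage {F : ℂ → ℂ} (hF : Integrable F areaMeasure) :
    ∫ ζ, F ζ ∂areaMeasure =
      ∫ s in Ioo (0 : ℝ) 1, (2 * s : ℝ) • Real.circleAverage F 0 s := by
  rw [integral_areaMeasure_polar hF]
  refine setIntegral_congr_fun measurableSet_Ioo fun s _ => ?_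
  have hp : Function.Periodic (fun θ => F (circleMap 0 s θ)) (2 * Real.pi) :=
    (periodic_circleMap 0 s).comp F
  have := hp.intervalIntegral_add_eq (-Real.pi) 0
  simp only [Real.circleAverage]
  rw [show (0 : ℝ) + 2 * Real.pi = 2 * Real.pi by ring,
    show -Real.pi + 2 * Real.pi = Real.pi by ring] at this
  rw [this]

theorem integrable_areaMeasure_radial {g : ℝ → ℝ} (hg : IntegrableOn g (Ico 0 1)) :
    Integrable (fun ζ : ℂ => g ‖ζ‖) areaMeasure := by
  rw [integrable_areaMeasure_iff, disc, integrableOn_fun_norm_addHaar]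
  have h : IntegrableOn g (Ioo 0 1) := hg.mono_set Ioo_subset_Ico_self
  refine Integrable.mono h (((continuous_pow _).aestronglyMeasurable).smul
    h.aestronglyMeasurable) ?_
  refine (ae_restrict_iff' measurableSet_Ioo).2 (ae_of_all _ fun s hs => ?_)
  rw [norm_smul]
  refine mul_le_of_le_one_left (norm_nonneg _) ?_
  simp only [Complex.finrank_real_complex, Nat.add_one_sub_one, pow_one, Real.norm_eq_abs,
    abs_of_pos hs.1]
  exact hs.2.le

/-! ### Moments and the reproducing kernel as a power series. -/

/-- The moments `∫_𝔻 |ζ|^{2n} ω dA`, written as one-dimensional integrals. -/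
def moment (ω : ℝ → ℝ) (n : ℕ) : ℝ := ∫ s in Ioo (0 : ℝ) 1, 2 * s ^ (2 * n + 1) * ω s

theorem IsRadialWeight.integrableOn_Ioo (hω : IsRadialWeight ω) : IntegrableOn ω (Ioo 0 1) :=
  hω.integrable.mono_set Ioo_subset_Ico_self

theorem IsRadialWeight.integrableOn_pow_mul (hω : IsRadialWeight ω) (k : ℕ) :
    IntegrableOn (fun s => 2 * s ^ k * ω s) (Ioo 0 1) := by
  refine Integrable.bdd_mul (c := 2) hω.integrableOn_Ioo
    (by fun_prop : Continuous fun s : ℝ => 2 * s ^ k).aestronglyMeasurable ?_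
  refine (ae_restrict_iff' measurableSet_Ioo).2 (ae_of_all _ fun s hs => ?_)
  have h0 : 0 ≤ s ^ k := pow_nonneg hs.1.le _
  rw [Real.norm_of_nonneg (by positivity)]
  linarith [pow_le_one₀ hs.1.le hs.2.le (n := k)]

theorem IsRadialWeight.le_moment (hω : IsRadialWeight ω) {ρ : ℝ} (h0 : 0 < ρ) (n : ℕ) :
    2 * ρ ^ (2 * n + 1) * tail ω ρ ≤ moment ω n := by
  have hsub : Ico ρ 1 ⊆ Ioo 0 1 := fun s hs => ⟨h0.trans_le hs.1, hs.2⟩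
  calc 2 * ρ ^ (2 * n + 1) * tail ω ρ
      = ∫ s in Ico ρ 1, 2 * ρ ^ (2 * n + 1) * ω s := by rw [integral_const_mul, tail]
    _ ≤ ∫ s in Ico ρ 1, 2 * s ^ (2 * n + 1) * ω s := by
        refine setIntegral_mono_on ((hω.integrableOn_Ioo.mono_set hsub).const_mul _)
          ((hω.integrableOn_pow_mul _).mono_set hsub) measurableSet_Ico fun s hs => ?_
        have := hω.nonneg s ⟨(hsub hs).1.le, hs.2⟩
        have := hs.1
        gcongr
    _ ≤ moment ω n := by
        refine setIntegral_mono_set (hω.integrableOn_pow_mul _) ?_ hsub.eventuallyLE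
        refine (ae_restrict_iff' measurableSet_Ioo).2 (ae_of_all _ fun s hs => ?_)
        have := hω.nonneg s ⟨hs.1.le, hs.2⟩
        have := hs.1
        simp only [Pi.zero_apply]
        positivity

theorem IsRadialWeight.moment_pos (hω : IsRadialWeight ω) (n : ℕ) : 0 < moment ω n := by
  have h := hω.le_moment (ρ := 1 / 2) (by norm_num) n
  have := hω.tail_pos (1 / 2) ⟨by norm_num, by norm_num⟩
  exact lt_of_lt_of_le (by positivity) h

/-- Since `ω` has mass on every `[ρ, 1)`, the moments are at least a constant times `ρ^{2n}`;
choosing `ρ² > x` leaves a geometric series. -/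
theorem IsRadialWeight.summable_pow_div_moment (hω : IsRadialWeight ω) {x : ℝ} (h0 : 0 ≤ x)
    (h1 : x < 1) : Summable fun n : ℕ => x ^ n / moment ω n := by
  obtain ⟨ρ, hρ0, hρ1, hρ⟩ : ∃ ρ : ℝ, 0 < ρ ∧ ρ < 1 ∧ x < ρ ^ 2 := by
    refine ⟨(1 + x) / 2, by linarith, by linarith,
      by nlinarith [pow_pos (sub_pos.2 h1) 2]⟩
  have ht := hω.tail_pos ρ ⟨hρ0.le, hρ1⟩
  have hg : Summable fun n : ℕ => (2 * ρ * tail ω ρ)⁻¹ * (x / ρ ^ 2) ^ n :=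
    (summable_geometric_of_lt_one (by positivity) ((div_lt_one (by positivity)).2 hρ)).mul_left _
  refine hg.of_nonneg_of_le (fun n => div_nonneg (by positivity) (hω.moment_pos n).le) fun n => ?_
  have h2 := hω.le_moment hρ0 n
  calc x ^ n / moment ω n ≤ x ^ n / (2 * ρ ^ (2 * n + 1) * tail ω ρ) := by gcongr
    _ = (2 * ρ * tail ω ρ)⁻¹ * (x / ρ ^ 2) ^ n := by
        rw [div_pow, ← pow_mul, pow_succ]
        field_simp

theorem differentiableOn_disc_tsum {c : ℕ → ℂ}
    (hc : ∀ x : ℝ, 0 ≤ x → x < 1 → Summable fun n => ‖c n‖ * x ^ n) :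
    DifferentiableOn ℂ (fun z => ∑' n, c n * z ^ n) disc := by
  intro z hz
  obtain ⟨x, hzx, hx1⟩ := exists_between (mem_disc.1 hz)
  have h := Complex.differentiableOn_tsum_of_summable_norm (F := fun n z => c n * z ^ n)
    (hc x ((norm_nonneg z).trans hzx.le) hx1) (fun n => by fun_prop) (Metric.isOpen_ball (x := 0) (ε := x))
    (fun n w hw => by
      rw [norm_mul, norm_pow]
      gcongr
      simpa using (Metric.mem_ball.1 hw).le)
  exact (h.differentiableAt (Metric.isOpen_ball.mem_nhds (by simpa using hzx))).differentiableWithinAt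

/-- The reproducing kernel of `A²_ω` as a power series. -/
def kernelSeries (ω : ℝ → ℝ) (z ζ : ℂ) : ℂ := ∑' n : ℕ, (conj z ^ n / (moment ω n : ℂ)) * ζ ^ n

theorem norm_kernel_term (hω : IsRadialWeight ω) (z ζ : ℂ) (n : ℕ) :
    ‖(conj z ^ n / (moment ω n : ℂ)) * ζ ^ n‖ = ‖z‖ ^ n / moment ω n * ‖ζ‖ ^ n := by
  simp [abs_of_pos (hω.moment_pos n)]

theorem summable_kernel_term (hω : IsRadialWeight ω) {z ζ : ℂ} (hz : z ∈ disc) (hζ : ζ ∈ disc) :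
    Summable fun n : ℕ => ‖(conj z ^ n / (moment ω n : ℂ)) * ζ ^ n‖ := by
  refine (hω.summable_pow_div_moment (norm_nonneg z) (mem_disc.1 hz)).of_nonneg_of_le
    (fun n => norm_nonneg _) fun n => ?_
  rw [norm_kernel_term hω]
  exact mul_le_of_le_one_right (div_nonneg (by positivity) (hω.moment_pos n).le)
    (pow_le_one₀ (norm_nonneg _) (mem_disc.1 hζ).le)

theorem norm_kernelSeries_le (hω : IsRadialWeight ω) {z ζ : ℂ} (hz : z ∈ disc) (hζ : ζ ∈ disc) :
    ‖kernelSeries ω z ζ‖ ≤ ∑' n : ℕ, ‖z‖ ^ n / moment ω n := by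
  refine (norm_tsum_le_tsum_norm (summable_kernel_term hω hz hζ)).trans ?_
  refine (summable_kernel_term hω hz hζ).tsum_le_tsum (fun n => ?_)
    (hω.summable_pow_div_moment (norm_nonneg z) (mem_disc.1 hz))
  rw [norm_kernel_term hω]
  exact mul_le_of_le_one_right (div_nonneg (by positivity) (hω.moment_pos n).le)
    (pow_le_one₀ (norm_nonneg _) (mem_disc.1 hζ).le)

theorem differentiableOn_kernelSeries (hω : IsRadialWeight ω) {z : ℂ} (hz : z ∈ disc) :
    DifferentiableOn ℂ (kernelSeries ω z) disc := by
  refine differentiableOn_disc_tsum (c := fun n => conj z ^ n / (moment ω n : ℂ)) fun x h0 h1 => ?_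
  have := summable_kernel_term hω hz (ζ := (x : ℂ)) (by simpa [mem_disc, abs_of_nonneg h0] using h1)
  simpa only [norm_mul, norm_pow, Complex.norm_real, Real.norm_eq_abs, abs_of_nonneg h0] using this

theorem aestronglyMeasurable_of_continuousOn_disc {f : ℂ → ℂ} (hf : ContinuousOn f disc) :
    AEStronglyMeasurable f areaMeasure :=
  aestronglyMeasurable_areaMeasure_iff.2 (hf.aestronglyMeasurable measurableSet_disc)

theorem IsRadialWeight.integrable_norm (hω : IsRadialWeight ω) :
    Integrable (fun ζ : ℂ => ω ‖ζ‖) areaMeasure :=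
  integrable_areaMeasure_radial hω.integrable

theorem IsRadialWeight.nonneg_norm (hω : IsRadialWeight ω) {ζ : ℂ} (hζ : ζ ∈ disc) : 0 ≤ ω ‖ζ‖ :=
  hω.nonneg _ ⟨norm_nonneg _, mem_disc.1 hζ⟩

theorem memBergman_of_bounded (hω : IsRadialWeight ω) {f : ℂ → ℂ} {M : ℝ}
    (hf : DifferentiableOn ℂ f disc) (hM : ∀ ζ ∈ disc, ‖f ζ‖ ≤ M) : MemBergman ω f := by
  refine ⟨hf, Integrable.bdd_mul (c := M ^ 2) hω.integrable_norm
    ((aestronglyMeasurable_of_continuousOn_disc hf.continuousOn).norm.pow 2)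
    (ae_areaMeasure_of_forall fun ζ hζ => ?_)⟩
  rw [norm_pow, norm_norm]
  exact pow_le_pow_left₀ (norm_nonneg _) (hM ζ hζ) 2

theorem MemBergman.integrable_mul (hω : IsRadialWeight ω) {f : ℂ → ℂ} (hf : MemBergman ω f) :
    Integrable (fun ζ => f ζ * (ω ‖ζ‖ : ℂ)) areaMeasure := by
  refine (hf.2.add hω.integrable_norm).mono
    ((aestronglyMeasurable_of_continuousOn_disc hf.1.continuousOn).mul
      hω.integrable_norm.ofReal.aestronglyMeasurable) (ae_areaMeasure_of_forall fun ζ hζ => ?_)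
  have h0 := hω.nonneg_norm hζ
  simp only [norm_mul, Complex.norm_real, Pi.add_apply, Real.norm_of_nonneg h0]
  rw [Real.norm_of_nonneg (by positivity)]
  nlinarith [sq_nonneg (‖f ζ‖ - 1), norm_nonneg (f ζ)]

theorem integrable_mul_conj_of_bounded {f k : ℂ → ℂ} {M : ℝ}
    (hf : Integrable (fun ζ => f ζ * (ω ‖ζ‖ : ℂ)) areaMeasure) (hk : ContinuousOn k disc)
    (hM : ∀ ζ ∈ disc, ‖k ζ‖ ≤ M) :
    Integrable (fun ζ => f ζ * conj (k ζ) * (ω ‖ζ‖ : ℂ)) areaMeasure := by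
  have h1 : AEStronglyMeasurable (fun ζ => conj (k ζ)) areaMeasure :=
    Complex.continuous_conj.comp_aestronglyMeasurable (aestronglyMeasurable_of_continuousOn_disc hk)
  refine (Integrable.bdd_mul (c := M) hf h1 (ae_areaMeasure_of_forall fun ζ hζ => ?_)).congr
    (ae_of_all _ fun ζ => by ring)
  simpa using hM ζ hζ

theorem integrable_mul_conj_kernelSeries (hω : IsRadialWeight ω) {f : ℂ → ℂ}
    (hf : Integrable (fun ζ => f ζ * (ω ‖ζ‖ : ℂ)) areaMeasure) {z : ℂ} (hz : z ∈ disc) :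
    Integrable (fun ζ => f ζ * conj (kernelSeries ω z ζ) * (ω ‖ζ‖ : ℂ)) areaMeasure :=
  integrable_mul_conj_of_bounded hf (differentiableOn_kernelSeries hω hz).continuousOn
    fun _ hζ => norm_kernelSeries_le hω hz hζ

theorem integrable_mul_conj_pow {f : ℂ → ℂ}
    (hf : Integrable (fun ζ => f ζ * (ω ‖ζ‖ : ℂ)) areaMeasure) (n : ℕ) :
    Integrable (fun ζ => f ζ * conj ζ ^ n * (ω ‖ζ‖ : ℂ)) areaMeasure := by
  have := integrable_mul_conj_of_bounded (k := fun ζ => ζ ^ n) (M := 1) hf (by fun_prop)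
    fun ζ hζ => by
      rw [norm_pow]
      exact pow_le_one₀ (norm_nonneg _) (mem_disc.1 hζ).le
  simpa only [map_pow] using this

theorem norm_integral_mul_conj_pow_le {f : ℂ → ℂ}
    (hf : Integrable (fun ζ => f ζ * (ω ‖ζ‖ : ℂ)) areaMeasure) (n : ℕ) :
    ∫ ζ, ‖f ζ * conj ζ ^ n * (ω ‖ζ‖ : ℂ)‖ ∂areaMeasure ≤
      ∫ ζ, ‖f ζ * (ω ‖ζ‖ : ℂ)‖ ∂areaMeasure := by
  refine integral_mono_ae (integrable_mul_conj_pow hf n).norm hf.norm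
    (ae_areaMeasure_of_forall fun ζ hζ => ?_)
  simp only [norm_mul, norm_pow, RCLike.norm_conj]
  gcongr
  exact mul_le_of_le_one_right (norm_nonneg _) (pow_le_one₀ (norm_nonneg _) (mem_disc.1 hζ).le)

/-- Termwise integration. Only `f ω ∈ L¹` is assumed, so that the expansion serves both the
reproducing property on `A²_ω` and projections of growth functions. -/
theorem hasSum_integral_mul_conj_kernelSeries (hω : IsRadialWeight ω) {f : ℂ → ℂ}
    (hf : Integrable (fun ζ => f ζ * (ω ‖ζ‖ : ℂ)) areaMeasure) {z : ℂ} (hz : z ∈ disc) :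
    HasSum (fun n : ℕ => (∫ ζ, f ζ * conj ζ ^ n * (ω ‖ζ‖ : ℂ) ∂areaMeasure) / moment ω n * z ^ n)
      (∫ ζ, f ζ * conj (kernelSeries ω z ζ) * (ω ‖ζ‖ : ℂ) ∂areaMeasure) := by
  have h := hasSum_integral_of_summable_integral_norm (μ := areaMeasure)
    (F := fun (n : ℕ) ζ => (z ^ n / (moment ω n : ℂ)) * (f ζ * conj ζ ^ n * (ω ‖ζ‖ : ℂ)))
    (fun n => (integrable_mul_conj_pow hf n).const_mul _) ?_
  · convert! h using 1
    · ext n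
      rw [integral_const_mul]
      ring
    · refine integral_congr_ae (ae_areaMeasure_of_forall fun ζ hζ => ?_)
      have hs := (summable_kernel_term hω hz hζ).of_norm.hasSum
      have hs' := ((Complex.hasSum_conj'.2 hs).mul_left (f ζ)).mul_right (ω ‖ζ‖ : ℂ)
      beta_reduce
      rw [kernelSeries, ← hs'.tsum_eq]
      refine tsum_congr fun n => ?_
      simp only [map_mul, map_div₀, map_pow, Complex.conj_conj, Complex.conj_ofReal]
      ring
  · refine ((hω.summable_pow_div_moment (norm_nonneg z) (mem_disc.1 hz)).mul_right
      (∫ ζ, ‖f ζ * (ω ‖ζ‖ : ℂ)‖ ∂areaMeasure)).of_nonneg_of_le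
      (fun n => integral_nonneg fun _ => norm_nonneg _) fun n => ?_
    simp_rw [norm_mul (z ^ n / (moment ω n : ℂ))]
    rw [integral_const_mul]
    refine mul_le_mul ?_ (norm_integral_mul_conj_pow_le hf n)
      (integral_nonneg fun _ => norm_nonneg _) (div_nonneg (by positivity) (hω.moment_pos n).le)
    simp [abs_of_pos (hω.moment_pos n)]

theorem differentiableOn_integral_mul_conj_kernelSeries (hω : IsRadialWeight ω) {f : ℂ → ℂ}
    (hf : Integrable (fun ζ => f ζ * (ω ‖ζ‖ : ℂ)) areaMeasure) :
    DifferentiableOn ℂ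
      (fun z => ∫ ζ, f ζ * conj (kernelSeries ω z ζ) * (ω ‖ζ‖ : ℂ) ∂areaMeasure) disc := by
  refine (differentiableOn_disc_tsum (c := fun n =>
    (∫ ζ, f ζ * conj ζ ^ n * (ω ‖ζ‖ : ℂ) ∂areaMeasure) / moment ω n) fun x h0 h1 => ?_).congr
    fun z hz => (hasSum_integral_mul_conj_kernelSeries hω hf hz).tsum_eq.symm
  refine ((hω.summable_pow_div_moment h0 h1).mul_left
      (∫ ζ, ‖f ζ * (ω ‖ζ‖ : ℂ)‖ ∂areaMeasure)).of_nonneg_of_le (fun n => by positivity) fun n => ?_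
  rw [norm_div, Complex.norm_real, Real.norm_of_nonneg (hω.moment_pos n).le, div_mul_eq_mul_div,
    mul_div_assoc]
  gcongr
  · exact div_nonneg (by positivity) (hω.moment_pos n).le
  · exact (norm_integral_le_integral_norm _).trans (norm_integral_mul_conj_pow_le hf n)

/-- On `|ζ| = s` one has `conj ζ = s²/ζ`, which turns the average into Cauchy's formula for the
`n`-th Taylor coefficient. -/
theorem circleAverage_mul_conj_pow {f : ℂ → ℂ} (hf : DifferentiableOn ℂ f disc) (n : ℕ) {s : ℝ}
    (h0 : 0 < s) (h1 : s < 1) :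
    Real.circleAverage (fun ζ => f ζ * conj ζ ^ n * (ω ‖ζ‖ : ℂ)) 0 s =
      (s ^ (2 * n) * ω s : ℝ) * ((n.factorial : ℂ)⁻¹ * iteratedDeriv n f 0) := by
  have hd : DifferentiableOn ℂ f (Metric.closedBall 0 s) :=
    hf.mono (Metric.closedBall_subset_ball h1)
  have hI := hd.circleIntegral_one_div_sub_center_pow_smul h0 n
  have hc : ∮ ζ in C(0, s), (ζ - 0)⁻¹ • (f ζ * conj ζ ^ n * (ω ‖ζ‖ : ℂ)) =
      ∮ ζ in C(0, s), ((s ^ (2 * n) * ω s : ℝ) : ℂ) • ((1 / (ζ - 0) ^ (n + 1)) • f ζ) := by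
    refine circleIntegral.integral_congr h0.le fun ζ hζ => ?_
    have hn : ‖ζ‖ = s := by simpa using hζ
    have hζ0 : ζ ≠ 0 := norm_ne_zero_iff.1 (by rw [hn]; exact h0.ne')
    have hc : conj ζ = (s : ℂ) ^ 2 / ζ := by
      rw [eq_div_iff hζ0, mul_comm, Complex.mul_conj, Complex.normSq_eq_norm_sq, hn]
      push_cast
      ring
    simp only [sub_zero, smul_eq_mul, hc, hn, div_pow, ← pow_mul, pow_succ ζ]
    push_cast
    field_simp
  rw [Real.circleAverage_eq_circleIntegral h0.ne', hc, circleIntegral.integral_smul, hI]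
  simp only [smul_eq_mul]
  have : (2 * Real.pi * Complex.I : ℂ) ≠ 0 := Complex.two_pi_I_ne_zero
  field_simp

theorem integral_mul_conj_pow (hω : IsRadialWeight ω) {f : ℂ → ℂ} (hf : MemBergman ω f) (n : ℕ) :
    ∫ ζ, f ζ * conj ζ ^ n * (ω ‖ζ‖ : ℂ) ∂areaMeasure =
      moment ω n * ((n.factorial : ℂ)⁻¹ * iteratedDeriv n f 0) := by
  rw [integral_areaMeasure_circleAverage (integrable_mul_conj_pow (hf.integrable_mul hω) n),
    moment, ← integral_complex_ofReal, ← integral_mul_const]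
  refine setIntegral_congr_fun measurableSet_Ioo fun s hs => ?_
  rw [circleAverage_mul_conj_pow hf.1 n hs.1 hs.2, Complex.real_smul]
  push_cast
  ring

theorem isReproducingKernel_kernelSeries (hω : IsRadialWeight ω) {z : ℂ} (hz : z ∈ disc) :
    IsReproducingKernel ω z (kernelSeries ω z) := by
  refine ⟨memBergman_of_bounded hω (differentiableOn_kernelSeries hω hz)
    fun _ hζ => norm_kernelSeries_le hω hz hζ, fun f hf => ?_⟩
  have h1 := hasSum_integral_mul_conj_kernelSeries hω (hf.integrable_mul hω) hz
  have h2 := Complex.hasSum_taylorSeries_on_ball (f := f) hf.1 hz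
  refine h2.unique ?_
  convert! h1 using 2 with n
  rw [integral_mul_conj_pow hω hf]
  have : (moment ω n : ℂ) ≠ 0 := Complex.ofReal_ne_zero.2 (hω.moment_pos n).ne'
  simp only [smul_eq_mul, sub_zero]
  field_simp

theorem IsReproducingKernel.conj_symm {z w : ℂ} {k l : ℂ → ℂ}
    (hk : IsReproducingKernel ω z k) (hl : IsReproducingKernel ω w l) : k w = conj (l z) := by
  rw [hl.2 k hk.1, hk.2 l hl.1, ← integral_conj]
  refine integral_congr_ae (ae_of_all _ fun ζ => ?_)
  simp only [map_mul, Complex.conj_conj, Complex.conj_ofReal]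
  ring

/-- Pairing any kernel at `z` with the series kernel at `ζ` determines its value at `ζ`, so the
chosen kernel and the series agree there. -/
theorem bergmanKernel_eq (hω : IsRadialWeight ω) {z ζ : ℂ} (hz : z ∈ disc) (hζ : ζ ∈ disc) :
    bergmanKernel ω z ζ = kernelSeries ω z ζ := by
  have hz' := isReproducingKernel_kernelSeries hω hz
  have hζ' := isReproducingKernel_kernelSeries hω hζ
  have h : IsReproducingKernel ω z (bergmanKernel ω z) := Classical.epsilon_spec ⟨_, hz'⟩
  rw [h.conj_symm hζ', hz'.conj_symm hζ']

theorem bergmanProjection_eq (hω : IsRadialWeight ω) (f : ℂ → ℂ) {z : ℂ} (hz : z ∈ disc) :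
    bergmanProjection ω f z =
      ∫ ζ, f ζ * conj (kernelSeries ω z ζ) * (ω ‖ζ‖ : ℂ) ∂areaMeasure :=
  integral_congr_ae (ae_areaMeasure_of_forall fun ζ hζ => by simp only [bergmanKernel_eq hω hz hζ])

theorem integrable_mul_bergmanKernel_iff (hω : IsRadialWeight ω) (f : ℂ → ℂ) {z : ℂ}
    (hz : z ∈ disc) :
    Integrable (fun ζ => f ζ * conj (bergmanKernel ω z ζ) * (ω ‖ζ‖ : ℂ)) areaMeasure ↔
      Integrable (fun ζ => f ζ * conj (kernelSeries ω z ζ) * (ω ‖ζ‖ : ℂ)) areaMeasure :=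
  integrable_congr (ae_areaMeasure_of_forall fun ζ hζ => by simp only [bergmanKernel_eq hω hz hζ])

/-! ### Tails of weights and the two doubling conditions. -/

theorem IsRadialWeight.integrableOn_tail (hν : IsRadialWeight ν) {r : ℝ} (hr : 0 ≤ r) :
    IntegrableOn ν (Ico r 1) :=
  hν.integrable.mono_set (Ico_subset_Ico_left hr)

theorem IsRadialWeight.tail_anti (hν : IsRadialWeight ν) {r s : ℝ} (hr : 0 ≤ r) (hrs : r ≤ s) :
    tail ν s ≤ tail ν r := by
  refine setIntegral_mono_set (hν.integrableOn_tail hr) ?_ (Ico_subset_Ico_left hrs).eventuallyLE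
  exact (ae_restrict_iff' measurableSet_Ico).2
    (ae_of_all _ fun t ht => hν.nonneg t ⟨hr.trans ht.1, ht.2⟩)

theorem IsRadialWeight.continuousOn_tail (hν : IsRadialWeight ν) :
    ContinuousOn (tail ν) (Ico 0 1) := by
  have hI : IntegrableOn ν (Icc 0 1) := (integrableOn_Icc_iff_integrableOn_Ico (by simp)).2 hν.integrable
  have h : ContinuousOn (fun r => tail ν 0 - ∫ s in Ioc 0 r, ν s) (Icc 0 1) :=
    continuousOn_const.sub (intervalIntegral.continuousOn_primitive hI)
  refine (h.mono Ico_subset_Icc_self).congr fun r hr => ?_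
  have hu : Ico (0 : ℝ) 1 = Ico 0 r ∪ Ico r 1 := (Ico_union_Ico_eq_Ico hr.1 hr.2.le).symm
  have hd : Disjoint (Ico 0 r) (Ico r 1) :=
    Set.disjoint_left.2 fun x hx hx' => absurd hx.2 (not_lt.2 hx'.1)
  simp only [tail]
  rw [hu, setIntegral_union hd measurableSet_Ico
    (hν.integrable.mono_set (Ico_subset_Ico_right hr.2.le)) (hν.integrableOn_tail hr.1),
    integral_Ioc_eq_integral_Ioo, ← integral_Ico_eq_integral_Ioo]
  ring

theorem IsRadialWeight.tail_norm_pos (hν : IsRadialWeight ν) {z : ℂ} (hz : z ∈ disc) :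
    0 < tail ν ‖z‖ :=
  hν.tail_pos _ ⟨norm_nonneg _, mem_disc.1 hz⟩

theorem IsRadialWeight.continuousOn_tail_norm (hν : IsRadialWeight ν) :
    ContinuousOn (fun z : ℂ => tail ν ‖z‖) disc :=
  hν.continuousOn_tail.comp continuous_norm.continuousOn
    fun _ hz => ⟨norm_nonneg _, mem_disc.1 hz⟩

theorem exists_of_eventually_nhdsLT_one {p : ℝ → Prop} (h : ∀ᶠ r in 𝓝[<] (1 : ℝ), p r) :
    ∃ r₀ : ℝ, 0 ≤ r₀ ∧ r₀ < 1 ∧ ∀ r, r₀ < r → r < 1 → p r := by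
  obtain ⟨l, hl, hs⟩ := mem_nhdsLT_iff_exists_Ioo_subset.1 h
  exact ⟨max l 0, le_max_right _ _, max_lt hl one_pos,
    fun r h1 h2 => hs ⟨(le_max_left _ _).trans_lt h1, h2⟩⟩

/-- Away from the boundary a constant suffices because the tail is monotone and positive. Writing
the constant as `2 ^ β` makes `β` the exponent of the polynomial bound. -/
theorem UpperDoubling.exists_pow (hν : IsRadialWeight ν) (hD : UpperDoubling ν) :
    ∃ β : ℕ, ∀ r, 0 ≤ r → r < 1 → tail ν r ≤ 2 ^ β * tail ν ((1 + r) / 2) := by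
  obtain ⟨C, -, hC⟩ := hD
  obtain ⟨r₀, h0, h1, hr₀⟩ := exists_of_eventually_nhdsLT_one hC
  have hp : 0 < tail ν ((1 + r₀) / 2) := hν.tail_pos _ ⟨by linarith, by linarith⟩
  obtain ⟨β, hβ⟩ := pow_unbounded_of_one_lt (max C (tail ν 0 / tail ν ((1 + r₀) / 2)))
    (one_lt_two : (1 : ℝ) < 2)
  refine ⟨β, fun r hr hr1 => ?_⟩
  have hpr : 0 < tail ν ((1 + r) / 2) := hν.tail_pos _ ⟨by linarith, by linarith⟩
  rcases lt_or_ge r₀ r with h | h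
  · exact (hr₀ r h hr1).trans
      (mul_le_mul_of_nonneg_right ((le_max_left _ _).trans hβ.le) hpr.le)
  · calc tail ν r ≤ tail ν 0 := hν.tail_anti le_rfl hr
      _ = tail ν 0 / tail ν ((1 + r₀) / 2) * tail ν ((1 + r₀) / 2) := by field_simp
      _ ≤ 2 ^ β * tail ν ((1 + r) / 2) := by
        gcongr
        · exact (le_max_right _ _).trans hβ.le
        · exact hν.tail_anti (by linarith) (by linarith)

/-- Upper doubling weights have tails that decay at most polynomially. -/
theorem UpperDoubling.exists_pow_mul_tail_le (hν : IsRadialWeight ν) (hD : UpperDoubling ν) :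
    ∃ (β : ℕ) (C : ℝ), 0 < C ∧ ∀ r s, 0 ≤ r → r ≤ s → s < 1 →
      (1 - s) ^ β * tail ν r ≤ C * (1 - r) ^ β * tail ν s := by
  obtain ⟨β, hβ⟩ := hD.exists_pow hν
  have hiter : ∀ (n : ℕ) (r : ℝ), 0 ≤ r → r < 1 →
      tail ν r ≤ (2 ^ β) ^ n * tail ν (1 - (1 - r) / 2 ^ n) := by
    intro n
    induction n with
    | zero => intro r _ _; simp
    | succ n ih =>
      intro r h0 h1
      have h2 : (1 : ℝ) ≤ 2 ^ n := one_le_pow₀ one_le_two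
      have h3 : (1 - r) / 2 ^ n ≤ 1 - r := div_le_self (by linarith) h2
      have h4 : 0 < (1 - r) / 2 ^ n := div_pos (by linarith) (by positivity)
      have h5 := hβ (1 - (1 - r) / 2 ^ n) (by linarith) (by linarith)
      rw [show (1 + (1 - (1 - r) / 2 ^ n)) / 2 = 1 - (1 - r) / 2 ^ (n + 1) by
        rw [pow_succ]; field_simp; ring] at h5
      calc tail ν r ≤ (2 ^ β) ^ n * tail ν (1 - (1 - r) / 2 ^ n) := ih r h0 h1
        _ ≤ (2 ^ β) ^ n * (2 ^ β * tail ν (1 - (1 - r) / 2 ^ (n + 1))) := by gcongr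
        _ = _ := by ring
  refine ⟨β, 2 ^ β, by positivity, fun r s hr hrs hs => ?_⟩
  have hs' : 0 < 1 - s := by linarith
  have hr' : 0 < 1 - r := by linarith
  -- The number of halvings of `1 - r` needed to pass below `1 - s`: `2^n ≤ (1-r)/(1-s) < 2^(n+1)`.
  obtain ⟨n, hn1, hn2⟩ := exists_nat_pow_near (x := (1 - r) / (1 - s))
    ((one_le_div hs').2 (by linarith)) (one_lt_two : (1 : ℝ) < 2)
  have h1 := hiter (n + 1) r hr (by linarith)
  have h2 : s ≤ 1 - (1 - r) / 2 ^ (n + 1) := by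
    have : (1 - r) / 2 ^ (n + 1) ≤ 1 - s := by
      rw [div_lt_iff₀ hs'] at hn2
      rw [div_le_iff₀ (by positivity)]
      linarith
    linarith
  have h3 := hν.tail_anti (hr.trans hrs) h2
  have hts := hν.tail_pos s ⟨hr.trans hrs, hs⟩
  rw [le_div_iff₀ hs'] at hn1
  calc (1 - s) ^ β * tail ν r
      ≤ (1 - s) ^ β * ((2 ^ β) ^ (n + 1) * tail ν s) := by
        gcongr
        exact h1.trans (by gcongr)
    _ = 2 ^ β * (2 ^ n * (1 - s)) ^ β * tail ν s := by
        rw [mul_pow, ← pow_mul, ← pow_mul, mul_add, pow_add, mul_one, mul_comm n β]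
        ring
    _ ≤ 2 ^ β * (1 - r) ^ β * tail ν s := by gcongr

theorem IsRadialWeight.continuousOn_inv_one_sub_mul_tail (hν : IsRadialWeight ν) :
    ContinuousOn (fun s => ((1 - s) * tail ν s)⁻¹) (Ico 0 1) :=
  ((continuousOn_const.sub continuousOn_id).mul hν.continuousOn_tail).inv₀ fun s hs =>
    (mul_pos (sub_pos.2 hs.2) (hν.tail_pos s hs)).ne'

theorem IsRadialWeight.intervalIntegrable_inv (hν : IsRadialWeight ν) {a b : ℝ} (ha : 0 ≤ a)
    (hab : a ≤ b) (hb : b < 1) :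
    IntervalIntegrable (fun s => ((1 - s) * tail ν s)⁻¹) volume a b := by
  refine (hν.continuousOn_inv_one_sub_mul_tail.mono ?_).intervalIntegrable
  rw [uIcc_of_le hab]
  exact fun s hs => ⟨ha.trans hs.1, hs.2.trans_lt hb⟩

theorem IsRadialWeight.integral_inv_le (hν : IsRadialWeight ν) {a b : ℝ} (ha : 0 ≤ a)
    (hab : a ≤ b) (hb : b < 1) :
    ∫ s in a..b, ((1 - s) * tail ν s)⁻¹ ≤ (b - a) * ((1 - b) * tail ν b)⁻¹ := by
  have hb' := hν.tail_pos b ⟨ha.trans hab, hb⟩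
  have := intervalIntegral.integral_mono_on hab (hν.intervalIntegrable_inv ha hab hb)
    (intervalIntegrable_const (c := ((1 - b) * tail ν b)⁻¹)) fun s hs => by
      have := hν.tail_anti (ha.trans hs.1) hs.2
      have h1 : 0 < 1 - b := by linarith
      have h2 : 1 - b ≤ 1 - s := by linarith [hs.2]
      have h3 : 0 < 1 - s := h1.trans_le h2
      gcongr
  rwa [intervalIntegral.integral_const, smul_eq_mul] at this

/-- For weights in `Ď`, the reciprocal of the tail has a logarithmic Dini property. -/
theorem LowerDoubling.exists_integral_inv_le (hν : IsRadialWeight ν) (hL : LowerDoubling ν) :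
    ∃ A : ℝ, 0 < A ∧ ∀ r, 0 ≤ r → r < 1 →
      ∫ s in (0 : ℝ)..r, ((1 - s) * tail ν s)⁻¹ ≤ A / tail ν r := by
  obtain ⟨K, C, hK, hC, h⟩ := hL
  obtain ⟨r₀, h0, h1, hr₀⟩ := exists_of_eventually_nhdsLT_one h
  obtain ⟨r₁, h01, h11⟩ := exists_between h1
  have hr₁0 : 0 ≤ r₁ := h0.trans h01.le
  set J : ℝ → ℝ := fun r => ∫ s in (0 : ℝ)..r, ((1 - s) * tail ν s)⁻¹ with hJ
  have hJadd : ∀ a b, 0 ≤ a → a ≤ b → b < 1 →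
      J b = J a + ∫ s in a..b, ((1 - s) * tail ν s)⁻¹ := fun a b ha hab hb =>
    (intervalIntegral.integral_add_adjacent_intervals
      (hν.intervalIntegrable_inv le_rfl ha (hab.trans_lt hb))
      (hν.intervalIntegrable_inv ha hab hb)).symm
  have hnn : ∀ a b, 0 ≤ a → a ≤ b → b < 1 → 0 ≤ ∫ s in a..b, ((1 - s) * tail ν s)⁻¹ :=
    fun a b ha hab hb => intervalIntegral.integral_nonneg hab fun s hs => by
      have := hν.tail_pos s ⟨ha.trans hs.1, hs.2.trans_lt hb⟩
      have : 0 < 1 - s := by linarith [hs.2]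
      positivity
  have ht0 := hν.tail_pos 0 ⟨le_rfl, one_pos⟩
  set A₀ : ℝ := J r₁ * tail ν 0 with hA₀
  have hA₀0 : 0 ≤ A₀ := mul_nonneg (hnn 0 r₁ le_rfl hr₁0 h11) ht0.le
  have hC1 : 0 < C - 1 := by linarith
  -- `A` solves `A - A/C = A₀ + (K - 1)`: the gain `C` of one doubling step then absorbs the
  -- integral `(K - 1)/ν̂(r)` over that step.
  set A : ℝ := (A₀ + (K - 1)) * C / (C - 1) with hA
  have hAC : A - A / C = A₀ + (K - 1) := by rw [hA]; field_simp
  have hA1 : A / C + (K - 1) ≤ A := by linarith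
  have hApos : 0 < A := by rw [hA]; exact div_pos (mul_pos (by linarith) (by linarith)) hC1
  have hA2 : A₀ + (K - 1) ≤ A := by
    have : 0 < A / C := by positivity
    linarith
  have hbase : ∀ r, 0 ≤ r → r < 1 → J r₁ ≤ A₀ / tail ν r := fun r hr hr1 => by
    have := hν.tail_pos r ⟨hr, hr1⟩
    rw [le_div_iff₀ this, hA₀]
    exact mul_le_mul_of_nonneg_left (hν.tail_anti le_rfl hr) (hnn 0 r₁ le_rfl hr₁0 h11)
  -- Induction on the number of `K`-adic steps that bring `r` back to `r₁`.
  have hind : ∀ (n : ℕ) (r : ℝ), 0 ≤ r → r < 1 → 1 - r₁ ≤ K ^ n * (1 - r) →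
      J r ≤ A / tail ν r := by
    have hlow : ∀ r, 0 ≤ r → r ≤ r₁ → J r ≤ A / tail ν r := fun r hr hr1 => by
      have ht := hν.tail_pos r ⟨hr, hr1.trans_lt h11⟩
      calc J r ≤ J r₁ := by
            rw [hJadd r r₁ hr hr1 h11]
            linarith [hnn r r₁ hr hr1 h11]
        _ ≤ A₀ / tail ν r := hbase r hr (hr1.trans_lt h11)
        _ ≤ A / tail ν r := by gcongr; linarith
    intro n
    induction n with
    | zero => intro r hr _ hn; exact hlow r hr (by linarith)
    | succ n ih =>
      intro r hr hr1 hn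
      rcases le_or_gt r r₁ with hrr | hrr
      · exact hlow r hr hrr
      have ht := hν.tail_pos r ⟨hr, hr1⟩
      have hr1' : 0 < 1 - r := by linarith
      -- The point whose `Ď`-successor `1 - (1 - r')/K` is `r`; here `r - r' = (K - 1)(1 - r)`.
      set r' : ℝ := 1 - K * (1 - r) with hr'
      have hrr' : r' ≤ r := by nlinarith
      rcases le_or_gt r₁ r' with hc | hc
      · have h2 := ih r' (hr₁0.trans hc) (by linarith) (by
          rw [hr', sub_sub_cancel, ← mul_assoc, ← pow_succ]; exact hn)
        have h3 := hr₀ r' (h01.trans_le hc) (by linarith)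
        rw [show 1 - (1 - r') / K = r by rw [hr']; field_simp; ring] at h3
        have h4 := hν.integral_inv_le (hr₁0.trans hc) hrr' hr1
        rw [hJadd r' r (hr₁0.trans hc) hrr' hr1]
        calc J r' + ∫ s in r'..r, ((1 - s) * tail ν s)⁻¹
            ≤ A / (C * tail ν r) + (r - r') * ((1 - r) * tail ν r)⁻¹ := by
              refine add_le_add (h2.trans ?_) h4
              gcongr
          _ = (A / C + (K - 1)) / tail ν r := by rw [hr']; field_simp; ring
          _ ≤ A / tail ν r := by gcongr
      -- Less than one step remains: lower doubling is not needed, and `r - r₁ ≤ r - r'`.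
      · have h4 := hν.integral_inv_le hr₁0 hrr.le hr1
        rw [hJadd r₁ r hr₁0 hrr.le hr1]
        calc J r₁ + ∫ s in r₁..r, ((1 - s) * tail ν s)⁻¹
            ≤ A₀ / tail ν r + (r - r') * ((1 - r) * tail ν r)⁻¹ := by
              refine add_le_add (hbase r hr hr1) (h4.trans ?_)
              gcongr
          _ = (A₀ + (K - 1)) / tail ν r := by rw [hr']; field_simp; ring
          _ ≤ A / tail ν r := by gcongr
  refine ⟨A, hApos, fun r hr hr1 => ?_⟩
  have hr1' : 0 < 1 - r := by linarith
  obtain ⟨n, hn⟩ := pow_unbounded_of_one_lt ((1 - r₁) / (1 - r)) hK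
  exact hind n r hr hr1 ((div_lt_iff₀ hr1').1 hn).le

/-! ### Growth norms. -/

theorem growthNorm_eq_ofReal (v : ℝ → ℝ) (f : ℂ → ℂ) :
    growthNorm v f = essSup (fun z => ENNReal.ofReal (‖f z‖ * v ‖z‖)) areaMeasure := by
  simp only [growthNorm, ENNReal.ofReal_mul (norm_nonneg _), ofReal_norm]

theorem growthNorm_le_ofReal {v : ℝ → ℝ} {f : ℂ → ℂ} {B : ℝ}
    (h : ∀ᵐ z ∂areaMeasure, ‖f z‖ * v ‖z‖ ≤ B) : growthNorm v f ≤ ENNReal.ofReal B := by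
  rw [growthNorm_eq_ofReal]
  exact essSup_le_of_ae_le _ (h.mono fun z hz => ENNReal.ofReal_le_ofReal hz)

theorem ae_norm_mul_le_growthNorm {v : ℝ → ℝ} {f : ℂ → ℂ} (h : growthNorm v f < ∞) :
    ∀ᵐ z ∂areaMeasure, ‖f z‖ * v ‖z‖ ≤ (growthNorm v f).toReal := by
  have := ENNReal.ae_le_essSup (μ := areaMeasure) fun z => ENNReal.ofReal (‖f z‖ * v ‖z‖)
  rw [← growthNorm_eq_ofReal] at this
  filter_upwards [this] with z hz
  exact (ENNReal.ofReal_le_iff_le_toReal h.ne).1 hz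

/-- A continuous function cannot exceed `B` on a null set only. This lets the essential bound on the
projection be used at the individual points `-r`. -/
theorem forall_disc_le_of_ae_le {g : ℂ → ℝ} {B : ℝ} (hg : ContinuousOn g disc)
    (h : ∀ᵐ z ∂areaMeasure, g z ≤ B) : ∀ z ∈ disc, g z ≤ B := by
  have ho : IsOpen (disc ∩ g ⁻¹' Ioi B) := hg.isOpen_inter_preimage isOpen_disc isOpen_Ioi
  have h0 : volume (disc ∩ g ⁻¹' Ioi B) = 0 := by
    have h1 : volume {z | ¬(z ∈ disc → g z ≤ B)} = 0 := ae_areaMeasure_iff.1 h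
    refine measure_mono_null (fun z hz => ?_) h1
    simp only [mem_ofPred_eq, not_forall, not_le]
    exact ⟨hz.1, hz.2⟩
  have he := ho.eq_empty_of_measure_zero h0
  intro z hz
  by_contra hlt
  exact (he ▸ (⟨hz, not_le.1 hlt⟩ : z ∈ disc ∩ g ⁻¹' Ioi B) : z ∈ (∅ : Set ℂ))

/-! ### Necessity: the sawtooth test function and a bound free of `ω`. -/

theorem integral_mul_exp_neg {k : ℝ} (hk : k ≠ 0) :
    ∫ θ in (-Real.pi)..Real.pi, (θ : ℂ) * Complex.exp (-(k * θ : ℝ) * Complex.I) =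
      (Complex.I / k) * (Real.pi * (Complex.exp (-(k * Real.pi : ℝ) * Complex.I) +
        Complex.exp ((k * Real.pi : ℝ) * Complex.I))) +
      (Complex.exp (-(k * Real.pi : ℝ) * Complex.I) -
        Complex.exp ((k * Real.pi : ℝ) * Complex.I)) / k ^ 2 := by
  have hk' : (k : ℂ) ≠ 0 := Complex.ofReal_ne_zero.2 hk
  have hd : ∀ θ : ℝ, HasDerivAt (fun θ : ℝ => (Complex.I / k) *
      (θ * Complex.exp (-(k * θ : ℝ) * Complex.I)) + Complex.exp (-(k * θ : ℝ) * Complex.I) / k ^ 2)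
      ((θ : ℂ) * Complex.exp (-(k * θ : ℝ) * Complex.I)) θ := by
    intro θ
    have h1 : HasDerivAt (fun θ : ℝ => (θ : ℂ)) 1 θ := Complex.ofRealCLM.hasDerivAt
    have h2 : HasDerivAt (fun θ : ℝ => -((k * θ : ℝ) : ℂ) * Complex.I) (-k * Complex.I) θ := by
      have := ((h1.const_mul (k : ℂ)).neg).mul_const Complex.I
      simpa using this
    have h3 := h2.cexp
    refine (((h1.mul h3).const_mul (Complex.I / k)).add (h3.div_const _)).congr_deriv ?_
    field_simp
    linear_combination (-(θ * k) : ℂ) * Complex.I_sq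
  rw [intervalIntegral.integral_eq_sub_of_hasDerivAt (fun θ _ => hd θ)
    (Continuous.intervalIntegrable (by fun_prop) _ _)]
  simp only [mul_neg, Complex.ofReal_neg, neg_neg]
  ring

theorem integral_mul_exp_neg_nat (n : ℕ) :
    ∫ θ in (-Real.pi)..Real.pi, (θ : ℂ) * Complex.exp (-(((n + 1 : ℕ) : ℝ) * θ : ℝ) * Complex.I) =
      2 * Real.pi * Complex.I * (-1) ^ (n + 1) / (n + 1 : ℕ) := by
  rw [integral_mul_exp_neg (by positivity)]
  have h1 : Complex.exp (((((n + 1 : ℕ) : ℝ) * Real.pi : ℝ) : ℂ) * Complex.I) = (-1) ^ (n + 1) := by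
    rw [← Complex.exp_pi_mul_I, ← Complex.exp_nat_mul]
    push_cast
    ring_nf
  have h2 : Complex.exp (-((((n + 1 : ℕ) : ℝ) * Real.pi : ℝ) : ℂ) * Complex.I) = (-1) ^ (n + 1) := by
    rw [neg_mul, Complex.exp_neg, h1, ← inv_pow]
    norm_num
  rw [h1, h2]
  simp only [Complex.ofReal_natCast]
  ring

/-- The extremal function `arg ζ · e^{-i arg ζ} / v(ζ)` of Hardy type. -/
def sawtooth (v : ℝ → ℝ) (ζ : ℂ) : ℂ :=
  ((ζ.arg / v ‖ζ‖ : ℝ) : ℂ) * Complex.exp (-(ζ.arg : ℂ) * Complex.I)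

theorem norm_sawtooth_mul_le (hν : IsRadialWeight ν) {ζ : ℂ} (hζ : ζ ∈ disc) :
    ‖sawtooth (tail ν) ζ‖ * tail ν ‖ζ‖ ≤ Real.pi := by
  have h := hν.tail_norm_pos hζ
  have he : ‖Complex.exp (-(ζ.arg : ℂ) * Complex.I)‖ = 1 := by
    rw [← Complex.ofReal_neg, Complex.norm_exp_ofReal_mul_I]
  rw [sawtooth, norm_mul, he, mul_one, Complex.norm_real, norm_div, Real.norm_of_nonneg h.le,
    div_mul_cancel₀ _ h.ne', Real.norm_eq_abs]
  exact Complex.abs_arg_le_pi ζ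

theorem aestronglyMeasurable_sawtooth (hν : IsRadialWeight ν) :
    AEStronglyMeasurable (sawtooth (tail ν)) areaMeasure := by
  have h1 := (aestronglyMeasurable_areaMeasure_iff (F := fun z : ℂ => tail ν ‖z‖)).2
    (hν.continuousOn_tail_norm.aestronglyMeasurable measurableSet_disc)
  have h2 : AEMeasurable (fun z : ℂ => z.arg / tail ν ‖z‖) areaMeasure :=
    Complex.measurable_arg.aemeasurable.div h1.aemeasurable
  refine AEMeasurable.aestronglyMeasurable ?_
  exact (Complex.measurable_ofReal.comp_aemeasurable h2).mul
    (Measurable.aemeasurable (by fun_prop))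

theorem memGrowth_sawtooth (hν : IsRadialWeight ν) : MemGrowth (tail ν) (sawtooth (tail ν)) :=
  ⟨aestronglyMeasurable_sawtooth hν, (growthNorm_le_ofReal
    (ae_areaMeasure_of_forall fun _ hζ => norm_sawtooth_mul_le hν hζ)).trans_lt ENNReal.ofReal_lt_top⟩

/-- The kernel at `z = 0` is the constant `1 / moment ω 0`, so absolute convergence at the origin
alone gives the claim. -/
theorem ProjectionBounded.integrable_mul (hω : IsRadialWeight ω) {v : ℝ → ℝ}
    (hP : ProjectionBounded ω v) {f : ℂ → ℂ} (hf : MemGrowth v f) :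
    Integrable (fun ζ => f ζ * (ω ‖ζ‖ : ℂ)) areaMeasure := by
  have h0 : (0 : ℂ) ∈ disc := by simp [mem_disc]
  have h := (integrable_mul_bergmanKernel_iff hω f h0).1 (hP.1 f hf 0 h0)
  have hk : ∀ ζ, kernelSeries ω 0 ζ = ((moment ω 0 : ℝ) : ℂ)⁻¹ := fun ζ => by
    rw [kernelSeries, tsum_eq_single 0 fun n hn => by simp [hn]]
    simp
  have hm : (moment ω 0 : ℂ) ≠ 0 := Complex.ofReal_ne_zero.2 (hω.moment_pos 0).ne'
  refine (h.const_mul (moment ω 0 : ℂ)).congr (ae_of_all _ fun ζ => ?_)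
  simp only [hk, map_inv₀, Complex.conj_ofReal]
  field_simp

theorem ProjectionBounded.integrableOn_div_tail (hω : IsRadialWeight ω) (hν : IsRadialWeight ν)
    (hP : ProjectionBounded ω (tail ν)) (n : ℕ) :
    IntegrableOn (fun s => 2 * s ^ (n + 1) * (ω s / tail ν s)) (Ioo 0 1) := by
  have hc : ContinuousOn (fun z : ℂ => (((tail ν ‖z‖)⁻¹ : ℝ) : ℂ)) disc :=
    Complex.continuous_ofReal.comp_continuousOn
      (hν.continuousOn_tail_norm.inv₀ fun z hz => (hν.tail_norm_pos hz).ne')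
  have hf : MemGrowth (tail ν) fun z => (((tail ν ‖z‖)⁻¹ : ℝ) : ℂ) := by
    refine ⟨aestronglyMeasurable_of_continuousOn_disc hc, (growthNorm_le_ofReal (B := 1)
      (ae_areaMeasure_of_forall fun z hz => ?_)).trans_lt ENNReal.ofReal_lt_top⟩
    have h := hν.tail_norm_pos hz
    rw [Complex.norm_real, Real.norm_of_nonneg (by positivity), inv_mul_cancel₀ h.ne']
  have h1 := (hP.integrable_mul hω hf).re
  have h2 : Integrable (fun z : ℂ => ω ‖z‖ / tail ν ‖z‖) areaMeasure := by
    refine h1.congr (ae_of_all _ fun z => ?_)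
    simp only [← Complex.ofReal_mul, RCLike.re_to_complex, Complex.ofReal_re]
    ring
  rw [integrable_areaMeasure_iff, disc] at h2
  have h3 := (integrableOn_fun_norm_addHaar (μ := (volume : Measure ℂ))
    (f := fun s => ω s / tail ν s)).1 h2
  simp only [Complex.finrank_real_complex, Nat.add_one_sub_one, pow_one, smul_eq_mul] at h3
  refine (Integrable.bdd_mul (c := 2) h3
    (by fun_prop : Continuous fun s : ℝ => 2 * s ^ n).aestronglyMeasurable ?_).congr
    (ae_of_all _ fun s => by ring)
  refine (ae_restrict_iff' measurableSet_Ioo).2 (ae_of_all _ fun s hs => ?_)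
  have h0 : 0 ≤ s ^ n := pow_nonneg hs.1.le _
  rw [Real.norm_of_nonneg (by positivity)]
  linarith [pow_le_one₀ hs.1.le hs.2.le (n := n)]

/-- The factor `e^{-i arg ζ}` of the sawtooth shifts the frequency from `n` to `n + 1`, so the
vanishing zeroth coefficient of `θ` never occurs. -/
theorem integral_sawtooth_mul_conj_pow
    (hf : Integrable (fun ζ => sawtooth (tail ν) ζ * (ω ‖ζ‖ : ℂ)) areaMeasure) (n : ℕ) :
    ∫ ζ, sawtooth (tail ν) ζ * conj ζ ^ n * (ω ‖ζ‖ : ℂ) ∂areaMeasure =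
      Complex.I * (-1) ^ (n + 1) / (n + 1 : ℕ) *
        ((∫ s in Ioo (0 : ℝ) 1, 2 * s ^ (n + 1) * (ω s / tail ν s) : ℝ) : ℂ) := by
  rw [integral_areaMeasure_polar (integrable_mul_conj_pow hf n), ← integral_complex_ofReal,
    ← integral_const_mul]
  refine setIntegral_congr_fun measurableSet_Ioo fun s hs => ?_
  have h1 : ∫ θ in (-Real.pi)..Real.pi, sawtooth (tail ν) (circleMap 0 s θ) *
      conj (circleMap 0 s θ) ^ n * (ω ‖circleMap 0 s θ‖ : ℂ) =
      ∫ θ in (-Real.pi)..Real.pi, ((s ^ n * (ω s / tail ν s) : ℝ) : ℂ) *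
        ((θ : ℂ) * Complex.exp (-(((n + 1 : ℕ) : ℝ) * θ : ℝ) * Complex.I)) := by
    refine intervalIntegral.integral_congr_ae (ae_of_all _ fun θ hθ => ?_)
    rw [uIoc_of_le (by linarith [Real.pi_pos])] at hθ
    have hn : ‖circleMap 0 s θ‖ = s := by simp [abs_of_pos hs.1]
    have ha : (circleMap 0 s θ).arg = θ := by
      simp only [circleMap, zero_add]
      rw [Complex.exp_mul_I, Complex.arg_mul_cos_add_sin_mul_I hs.1 hθ]
    have hc : conj (circleMap 0 s θ) = s * Complex.exp (-(θ : ℂ) * Complex.I) := by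
      simp only [circleMap, zero_add, map_mul, Complex.conj_ofReal, ← Complex.exp_conj,
        Complex.conj_I]
      congr 2
      ring
    rw [sawtooth, hn, ha, hc, mul_pow, ← Complex.exp_nat_mul,
      show (-((((n + 1 : ℕ) : ℝ) * θ : ℝ) : ℂ) * Complex.I) =
        (n : ℂ) * (-(θ : ℂ) * Complex.I) + -(θ : ℂ) * Complex.I by push_cast; ring, Complex.exp_add]
    push_cast
    ring
  rw [h1, intervalIntegral.integral_const_mul, integral_mul_exp_neg_nat, Complex.real_smul,
    Complex.real_smul]
  have hpi : (Real.pi : ℂ) ≠ 0 := Complex.ofReal_ne_zero.2 Real.pi_ne_zero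
  have hn : ((n + 1 : ℕ) : ℂ) ≠ 0 := by exact_mod_cast Nat.succ_ne_zero n
  push_cast at hn ⊢
  field_simp
  ring

/-- With `y = (n+1)(1-s)`, combine `s^n ≤ e · e^{-y}` with `y^β ≤ β! e^y`. -/
theorem pow_mul_pow_one_sub_le {s : ℝ} (h0 : 0 ≤ s) (h1 : s < 1) (n β : ℕ) :
    s ^ n * ((n + 1) * (1 - s)) ^ β ≤ Real.exp 1 * β.factorial := by
  set x : ℝ := 1 - s with hx
  have hx0 : 0 < x := by linarith
  have hsx : s ^ n ≤ Real.exp 1 * Real.exp (-((n + 1) * x)) := by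
    calc s ^ n ≤ Real.exp (-x) ^ n := by
          gcongr
          linarith [Real.add_one_le_exp (-x)]
      _ = Real.exp (-(n * x)) := by rw [← Real.exp_nat_mul]; ring_nf
      _ ≤ Real.exp (1 + -((n + 1) * x)) := by
          gcongr
          linarith
      _ = _ := Real.exp_add _ _
  have hy := Real.pow_div_factorial_le_exp ((n + 1) * x) (by positivity) β
  rw [div_le_iff₀ (by positivity)] at hy
  calc s ^ n * ((n + 1) * x) ^ β
      ≤ (Real.exp 1 * Real.exp (-((n + 1) * x))) * (Real.exp ((n + 1) * x) * β.factorial) := by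
        gcongr
    _ = Real.exp 1 * β.factorial := by
        rw [Real.exp_neg]
        field_simp

/-- For upper doubling weights the tail at `s`, damped by `s^n`, is controlled by the tail at
`1 - 1/(n+1)`, uniformly in `s`. -/
theorem UpperDoubling.exists_pow_mul_tail_le_tail (hν : IsRadialWeight ν) (hD : UpperDoubling ν) :
    ∃ D : ℝ, 0 < D ∧ ∀ (n : ℕ) (s : ℝ), 0 ≤ s → s < 1 →
      s ^ n * tail ν s ≤ D * tail ν (1 - 1 / (n + 1)) := by
  obtain ⟨β, C, hC, h⟩ := hD.exists_pow_mul_tail_le hν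
  refine ⟨max 1 (C * (Real.exp 1 * β.factorial)), by positivity, fun n s h0 h1 => ?_⟩
  have hn : (0 : ℝ) < n + 1 := by positivity
  have hρ0 : (0 : ℝ) ≤ 1 - 1 / (n + 1) := by
    rw [sub_nonneg, div_le_one hn]
    linarith [n.cast_nonneg (α := ℝ)]
  have hρ1 : (1 : ℝ) - 1 / (n + 1) < 1 := by linarith [one_div_pos.2 hn]
  have ht := hν.tail_pos _ ⟨hρ0, hρ1⟩
  have hs := hν.tail_pos s ⟨h0, h1⟩
  -- Beyond `1 - 1/(n+1)` monotonicity of the tail is enough; before it, the polynomial loss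
  -- `((n+1)(1-s))^β` is absorbed by `s^n`.
  rcases le_or_gt (1 - 1 / ((n : ℝ) + 1)) s with hc | hc
  · calc s ^ n * tail ν s ≤ 1 * tail ν (1 - 1 / (n + 1)) := by
          gcongr
          · exact pow_le_one₀ h0 h1.le
          · exact hν.tail_anti hρ0 hc
      _ ≤ _ := by
          gcongr
          exact le_max_left _ _
  · have h2 := h s _ h0 hc.le hρ1
    rw [sub_sub_cancel] at h2
    have h3 : tail ν s ≤ C * ((n + 1) * (1 - s)) ^ β * tail ν (1 - 1 / (n + 1)) := by
      calc tail ν s = (n + 1 : ℝ) ^ β * ((1 / ((n : ℝ) + 1)) ^ β * tail ν s) := by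
            rw [← mul_assoc, ← mul_pow, mul_one_div_cancel hn.ne', one_pow, one_mul]
        _ ≤ (n + 1 : ℝ) ^ β * (C * (1 - s) ^ β * tail ν (1 - 1 / (n + 1))) := by gcongr
        _ = _ := by rw [mul_pow]; ring
    calc s ^ n * tail ν s
        ≤ s ^ n * (C * ((n + 1) * (1 - s)) ^ β * tail ν (1 - 1 / (n + 1))) := by gcongr
      _ = C * (s ^ n * ((n + 1) * (1 - s)) ^ β) * tail ν (1 - 1 / (n + 1)) := by ring
      _ ≤ C * (Real.exp 1 * β.factorial) * tail ν (1 - 1 / (n + 1)) :=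
          mul_le_mul_of_nonneg_right
            (mul_le_mul_of_nonneg_left (pow_mul_pow_one_sub_le h0 h1 n β) hC.le) ht.le
      _ ≤ _ := by
          gcongr
          exact le_max_right _ _

/-- Split `s^{2n+1} = s^n · s^{n+1}` and spend `s^n` on the tail of `ν`. The ratio of the integral
to the moment is thus bounded below independently of `ω`. -/
theorem UpperDoubling.exists_moment_le (hω : IsRadialWeight ω) (hν : IsRadialWeight ν)
    (hD : UpperDoubling ν) (hP : ProjectionBounded ω (tail ν)) :
    ∃ D : ℝ, 0 < D ∧ ∀ n : ℕ, moment ω n ≤ D * tail ν (1 - 1 / (n + 1)) *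
      ∫ s in Ioo (0 : ℝ) 1, 2 * s ^ (n + 1) * (ω s / tail ν s) := by
  obtain ⟨D, hD0, h⟩ := hD.exists_pow_mul_tail_le_tail hν
  refine ⟨D, hD0, fun n => ?_⟩
  rw [moment, ← integral_const_mul]
  refine setIntegral_mono_on (hω.integrableOn_pow_mul _)
    ((hP.integrableOn_div_tail hω hν n).const_mul _) measurableSet_Ioo fun s hs => ?_
  have ht := hν.tail_pos s ⟨hs.1.le, hs.2⟩
  have hw := hω.nonneg s ⟨hs.1.le, hs.2⟩
  have hs0 := hs.1
  have h1 := h n s hs.1.le hs.2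
  calc 2 * s ^ (2 * n + 1) * ω s
      = (s ^ n * tail ν s) * (2 * s ^ (n + 1) * (ω s / tail ν s)) := by
        rw [show 2 * n + 1 = n + (n + 1) by ring, pow_add]
        field_simp
    _ ≤ _ := by gcongr

theorem ProjectionBounded.exists_sum_le (hω : IsRadialWeight ω) (hν : IsRadialWeight ν)
    (hD : UpperDoubling ν) (hP : ProjectionBounded ω (tail ν)) :
    ∃ M : ℝ, 0 < M ∧ ∀ (r : ℝ) (F : Finset ℕ), 0 ≤ r → r < 1 →
      ∑ n ∈ F, r ^ n / ((n + 1) * tail ν (1 - 1 / (n + 1))) ≤ M / tail ν r := by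
  obtain ⟨D, hD0, hmom⟩ := hD.exists_moment_le hω hν hP
  obtain ⟨-, C, hC⟩ := id hP
  have hg := memGrowth_sawtooth hν
  have hf := hP.integrable_mul hω hg
  set Q := bergmanProjection ω (sawtooth (tail ν)) with hQ
  obtain ⟨⟨⟨-, hfin⟩, hdiff⟩, -⟩ := hC _ hg
  rw [← hQ] at hfin hdiff
  set B := (growthNorm (tail ν) Q).toReal with hB
  have hbound : ∀ z ∈ disc, ‖Q z‖ * tail ν ‖z‖ ≤ B :=
    forall_disc_le_of_ae_le (hdiff.continuousOn.norm.mul hν.continuousOn_tail_norm)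
      (ae_norm_mul_le_growthNorm hfin)
  set I : ℕ → ℝ := fun n => ∫ s in Ioo (0 : ℝ) 1, 2 * s ^ (n + 1) * (ω s / tail ν s) with hI
  have hI0 : ∀ n, 0 ≤ I n := fun n => setIntegral_nonneg measurableSet_Ioo fun s hs => by
    have ht := hν.tail_pos s ⟨hs.1.le, hs.2⟩
    have hw := hω.nonneg s ⟨hs.1.le, hs.2⟩
    have hs0 := hs.1
    positivity
  have hB0 : 0 ≤ B := ENNReal.toReal_nonneg
  refine ⟨D * (B + 1), by positivity, fun r F h0 h1 => ?_⟩
  have htr := hν.tail_pos r ⟨h0, h1⟩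
  -- At `-r` the signs cancel, `i · i · (-1)^{n+1} · (-1)^n = 1`, so the series of `i · Q(-r)` has
  -- nonnegative terms and bounds its partial sums.
  have hz : (-r : ℂ) ∈ disc := by simpa [mem_disc, abs_of_nonneg h0] using h1
  have hsum := hasSum_integral_mul_conj_kernelSeries hω hf hz
  rw [← bergmanProjection_eq hω _ hz, ← hQ] at hsum
  have hsum' : HasSum (fun n : ℕ => I n / moment ω n * r ^ n / (n + 1)) (Complex.I * Q (-r)).re := by
    have h2 := Complex.hasSum_re (hsum.mul_left Complex.I)
    convert! h2 using 2 with n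
    rw [integral_sawtooth_mul_conj_pow hf]
    have h3 : Complex.I * (Complex.I * (-1) ^ (n + 1) / (n + 1 : ℕ) * ((I n : ℝ) : ℂ) /
        (moment ω n : ℂ) * (-r : ℂ) ^ n) = ((I n / moment ω n * r ^ n / (n + 1) : ℝ) : ℂ) := by
      have h4 : ((-1 : ℂ)) ^ n * (-1) ^ n = 1 := by rw [← mul_pow]; simp
      rw [neg_pow (r : ℂ) n, pow_succ]
      push_cast
      linear_combination (-(I n : ℂ) / moment ω n * r ^ n / (n + 1) * ((-1) ^ n * (-1) ^ n)) *
        Complex.I_sq + ((I n : ℂ) / moment ω n * r ^ n / (n + 1)) * h4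
    rw [h3, Complex.ofReal_re]
  have hle : ∑ n ∈ F, I n / moment ω n * r ^ n / (n + 1) ≤ B / tail ν r := by
    refine (sum_le_hasSum F (fun n _ => ?_) hsum').trans ?_
    · have := hI0 n
      have := hω.moment_pos n
      positivity
    · refine (Complex.re_le_norm _).trans ?_
      rw [norm_mul, Complex.norm_I, one_mul, le_div_iff₀ htr]
      simpa [abs_of_nonneg h0] using hbound _ hz
  calc ∑ n ∈ F, r ^ n / ((n + 1) * tail ν (1 - 1 / (n + 1)))
      ≤ ∑ n ∈ F, D * (I n / moment ω n * r ^ n / (n + 1)) := by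
        refine Finset.sum_le_sum fun n _ => ?_
        have hm := hω.moment_pos n
        have hn : (0 : ℝ) < n + 1 := by positivity
        have ht : 0 < tail ν (1 - 1 / (n + 1)) := hν.tail_pos _ ⟨by
          rw [sub_nonneg, div_le_one hn]
          linarith [n.cast_nonneg (α := ℝ)], by linarith [one_div_pos.2 hn]⟩
        have h5 : 1 / tail ν (1 - 1 / (n + 1)) ≤ D * (I n / moment ω n) := by
          rw [div_le_iff₀ ht, ← mul_div_assoc, div_mul_eq_mul_div, le_div_iff₀ hm, one_mul]
          linarith [hmom n]
        calc r ^ n / ((n + 1) * tail ν (1 - 1 / (n + 1)))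
            = 1 / tail ν (1 - 1 / (n + 1)) * (r ^ n / (n + 1)) := by field_simp
          _ ≤ D * (I n / moment ω n) * (r ^ n / (n + 1)) := by gcongr
          _ = _ := by ring
    _ = D * ∑ n ∈ F, I n / moment ω n * r ^ n / (n + 1) := by rw [Finset.mul_sum]
    _ ≤ D * (B / tail ν r) := by gcongr
    _ ≤ D * (B + 1) / tail ν r := by
        rw [← mul_div_assoc]
        gcongr
        linarith

/-! ### Necessity: from the summed bound to lower doubling. -/

theorem half_le_sum_inv {N : ℕ} (hN : 0 < N) (j : ℕ) :
    (j : ℝ) / 2 ≤ ∑ k ∈ Finset.Ico N (2 ^ j * N), (1 / k : ℝ) := by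
  induction j with
  | zero => simp
  | succ j ih =>
    have h1 : N ≤ 2 ^ j * N := Nat.le_mul_of_pos_left _ (by positivity)
    have h2 : 2 ^ j * N ≤ 2 ^ (j + 1) * N := by gcongr <;> omega
    rw [← Finset.sum_Ico_consecutive _ h1 h2]
    have h3 : (1 / 2 : ℝ) ≤ ∑ k ∈ Finset.Ico (2 ^ j * N) (2 ^ (j + 1) * N), (1 / k : ℝ) := by
      have h4 : ∀ k ∈ Finset.Ico (2 ^ j * N) (2 ^ (j + 1) * N),
          (1 / (2 ^ (j + 1) * N) : ℝ) ≤ 1 / k := fun k hk => by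
        rw [Finset.mem_Ico] at hk
        have h5 : 0 < k := lt_of_lt_of_le (by positivity) hk.1
        have h6 : (k : ℝ) ≤ 2 ^ (j + 1) * N := by exact_mod_cast hk.2.le
        have h7 : (0 : ℝ) < k := by exact_mod_cast h5
        gcongr
      have h8 := Finset.card_nsmul_le_sum _ _ _ h4
      rw [Nat.card_Ico, nsmul_eq_mul, Nat.cast_sub h2] at h8
      refine le_trans (le_of_eq ?_) h8
      have : (N : ℝ) ≠ 0 := by exact_mod_cast hN.ne'
      push_cast
      field_simp
      ring
    push_cast
    linarith

theorem lowerDoubling_of_sum_le (hν : IsRadialWeight ν) {M : ℝ} (hM : 0 < M)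
    (h : ∀ (r : ℝ) (F : Finset ℕ), 0 ≤ r → r < 1 →
      ∑ n ∈ F, r ^ n / ((n + 1) * tail ν (1 - 1 / (n + 1))) ≤ M / tail ν r) :
    LowerDoubling ν := by
  obtain ⟨j, hj⟩ := exists_nat_ge (8 * M)
  have hj0 : (0 : ℝ) ≤ j := j.cast_nonneg
  -- `j ≥ 8M` makes the harmonic block beat the constant `M` with factor 2. The extra `2^2` in `K`
  -- keeps `R^n ≥ 1/2` on the whole block, as `n(1-r)/K ≤ 2^j · 2 / 2^(j+2)`.
  refine ⟨2 ^ (j + 2), 2, one_lt_pow₀ one_lt_two (by omega), one_lt_two, ?_⟩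
  filter_upwards [Ioo_mem_nhdsLT (show (0 : ℝ) < 1 from one_pos)] with r hr
  have ht : 0 < 1 - r := sub_pos.2 hr.2
  have ht1 : 1 - r < 1 := by linarith [hr.1]
  set K : ℝ := 2 ^ (j + 2) with hK
  have hK1 : 1 < K := one_lt_pow₀ one_lt_two (by omega)
  set R : ℝ := 1 - (1 - r) / K with hR
  have hx : 0 < (1 - r) / K := by positivity
  have hx1 : (1 - r) / K < 1 := (div_lt_one (by positivity)).2 (by linarith)
  obtain ⟨N, hN1, hN2⟩ : ∃ N : ℕ, 1 / (1 - r) ≤ N ∧ (N : ℝ) < 1 / (1 - r) + 1 :=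
    ⟨⌈1 / (1 - r)⌉₊, Nat.le_ceil _, Nat.ceil_lt_add_one (by positivity)⟩
  have hN0 : 0 < N := by
    have : (0 : ℝ) < N := lt_of_lt_of_le (by positivity) hN1
    exact_mod_cast this
  have hNt : (N : ℝ) * (1 - r) ≤ 2 := by
    have : (N : ℝ) * (1 - r) < (1 / (1 - r) + 1) * (1 - r) := by gcongr
    rw [add_mul, one_div_mul_cancel ht.ne'] at this
    linarith
  have htr := hν.tail_pos r ⟨hr.1.le, hr.2⟩
  have htR := hν.tail_pos R ⟨by linarith, by linarith⟩
  -- The block is indexed by `k = n + 1 ∈ [N, 2^j N)`, with `N` about `1/(1-r)`; there `1 - 1/(n+1)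
  -- ≥ r`, so `ν̂` is at most `ν̂(r)`.
  have h1 := h R ((Finset.Ico N (2 ^ j * N)).image Nat.pred) (by linarith) (by linarith)
  have hinj : Set.InjOn Nat.pred (Finset.Ico N (2 ^ j * N) : Set ℕ) := by
    intro a ha b hb hab
    simp only [Finset.coe_Ico, Set.mem_Ico] at ha hb
    simp only [Nat.pred_eq_sub_one] at hab
    omega
  rw [Finset.sum_image hinj] at h1
  have h2 : ∀ k ∈ Finset.Ico N (2 ^ j * N), 1 / (2 * tail ν r) * (1 / k : ℝ) ≤
      R ^ (Nat.pred k) / (((Nat.pred k : ℕ) + 1) * tail ν (1 - 1 / ((Nat.pred k : ℕ) + 1))) := by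
    intro k hk
    rw [Finset.mem_Ico] at hk
    obtain ⟨n, rfl⟩ : ∃ n, k = n + 1 := ⟨k - 1, by omega⟩
    simp only [Nat.pred_succ, Nat.cast_add, Nat.cast_one]
    have hn : (0 : ℝ) < n + 1 := by positivity
    have hNn : (N : ℝ) ≤ n + 1 := by exact_mod_cast hk.1
    have hnN : (n : ℝ) + 1 ≤ 2 ^ j * N := by exact_mod_cast hk.2.le
    have h3 : r ≤ 1 - 1 / ((n : ℝ) + 1) := by
      have : 1 / ((n : ℝ) + 1) ≤ 1 - r := by
        rw [div_le_iff₀ ht] at hN1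
        rw [div_le_iff₀ hn]
        nlinarith
      linarith
    have h4 := hν.tail_anti hr.1.le h3
    have h4' : 0 < tail ν (1 - 1 / ((n : ℝ) + 1)) :=
      hν.tail_pos _ ⟨hr.1.le.trans h3, by linarith [one_div_pos.2 hn]⟩
    have h5 : (1 / 2 : ℝ) ≤ R ^ n := by
      have h6 := one_add_mul_le_pow (a := -((1 - r) / K)) (by linarith) n
      rw [← sub_eq_add_neg, ← hR] at h6
      have h7 : (n : ℝ) * ((1 - r) / K) ≤ 1 / 2 := by
        rw [← mul_div_assoc, div_le_iff₀ (by positivity), hK, pow_add]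
        have : ((n : ℝ) + 1) * (1 - r) ≤ 2 ^ j * N * (1 - r) := by gcongr
        have h8 : (2 : ℝ) ^ j * (N * (1 - r)) ≤ 2 ^ j * 2 := by gcongr
        nlinarith
      linarith
    calc 1 / (2 * tail ν r) * (1 / ((n : ℝ) + 1)) = (1 / 2) / ((n + 1) * tail ν r) := by field_simp
      _ ≤ _ := by gcongr
  have h9 := (Finset.sum_le_sum h2).trans h1
  rw [← Finset.mul_sum] at h9
  have h10 : 1 / (2 * tail ν r) * ((j : ℝ) / 2) ≤ M / tail ν R :=
    le_trans (by gcongr; exact half_le_sum_inv hN0 j) h9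
  rw [le_div_iff₀ htR] at h10
  have h11 : (j : ℝ) * tail ν R ≤ 4 * M * tail ν r := by
    calc (j : ℝ) * tail ν R = (1 / (2 * tail ν r) * ((j : ℝ) / 2) * tail ν R) * (4 * tail ν r) := by
          field_simp
          ring
      _ ≤ M * (4 * tail ν r) := by gcongr
      _ = _ := by ring
  nlinarith

/-- If some Bergman projection is bounded on the growth space of an upper doubling weight, then
the weight is lower doubling. -/
theorem ProjectionBounded.lowerDoubling (hω : IsRadialWeight ω) (hν : IsRadialWeight ν)
    (hD : UpperDoubling ν) (hP : ProjectionBounded ω (tail ν)) : LowerDoubling ν := by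
  obtain ⟨M, hM, h⟩ := hP.exists_sum_le hω hν hD
  exact lowerDoubling_of_sum_le hν hM h

/-! ### Sufficiency: standard weights and their kernels. -/

/-- The standard radial weight `(1 - s²)^α`. -/
def standardWeight (α : ℕ) (s : ℝ) : ℝ := (1 - s ^ 2) ^ α

theorem continuous_standardWeight (α : ℕ) : Continuous (standardWeight α) := by
  unfold standardWeight
  fun_prop

theorem standardWeight_pos (α : ℕ) {s : ℝ} (h0 : 0 ≤ s) (h1 : s < 1) : 0 < standardWeight α s :=
  pow_pos (by nlinarith) α

theorem standardWeight_le (α : ℕ) {s : ℝ} (h0 : 0 ≤ s) (h1 : s < 1) :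
    standardWeight α s ≤ 2 ^ α * (1 - s) ^ α := by
  rw [standardWeight, ← mul_pow]
  exact pow_le_pow_left₀ (by nlinarith) (by nlinarith) α

theorem isRadialWeight_standardWeight (α : ℕ) : IsRadialWeight (standardWeight α) := by
  have hint : IntegrableOn (standardWeight α) (Ico 0 1) :=
    (continuous_standardWeight α).continuousOn.integrableOn_Icc.mono_set Ico_subset_Icc_self
  refine ⟨fun r hr => (standardWeight_pos α hr.1 hr.2).le, hint, fun r hr => ?_⟩
  rw [tail, integral_Ico_eq_integral_Ioo, ← integral_Ioc_eq_integral_Ioo,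
    ← intervalIntegral.integral_of_le hr.2.le]
  exact intervalIntegral.intervalIntegral_pos_of_pos_on
    ((continuous_standardWeight α).intervalIntegrable _ _)
    (fun s hs => standardWeight_pos α (hr.1.trans hs.1.le) hs.2) hr.2

/-- A Beta integral: the factor `1 - s²` gives the recursion `m_n(α+1) = m_n(α) - m_{n+1}(α)`. -/
theorem moment_standardWeight (α n : ℕ) :
    moment (standardWeight α) n = (n.factorial * α.factorial : ℝ) / (n + α + 1).factorial := by
  induction α generalizing n with
  | zero =>
    simp only [moment, standardWeight, pow_zero, mul_one]
    rw [← integral_Ioc_eq_integral_Ioo, ← intervalIntegral.integral_of_le zero_le_one,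
      intervalIntegral.integral_const_mul, integral_pow]
    simp only [add_zero, Nat.factorial_succ, Nat.factorial_zero]
    have := n.factorial_ne_zero
    push_cast
    field_simp
    ring
  | succ α ih =>
    have h : moment (standardWeight (α + 1)) n =
        moment (standardWeight α) n - moment (standardWeight α) (n + 1) := by
      have hi := fun k => (isRadialWeight_standardWeight α).integrableOn_pow_mul k
      simp only [moment]
      rw [← integral_sub (hi _) (hi _)]
      refine setIntegral_congr_fun measurableSet_Ioo fun s _ => ?_
      simp only [standardWeight]
      ring
    rw [h, ih, ih]
    have e1 : n + 1 + α + 1 = n + α + 1 + 1 := by ring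
    have e2 : n + (α + 1) + 1 = n + α + 1 + 1 := by ring
    rw [e1, e2]
    simp only [Nat.factorial_succ]
    have := n.factorial_ne_zero
    have := (n + α).factorial_ne_zero
    push_cast
    field_simp
    ring

theorem kernelSeries_standardWeight (α : ℕ) {z ζ : ℂ} (hz : z ∈ disc) (hζ : ζ ∈ disc) :
    kernelSeries (standardWeight α) z ζ = (α + 1) / (1 - conj z * ζ) ^ (α + 2) := by
  have hx : ‖conj z * ζ‖ < 1 := by
    rw [norm_mul, RCLike.norm_conj]
    exact mul_lt_one_of_nonneg_of_lt_one_left (norm_nonneg _) (mem_disc.1 hz) (mem_disc.1 hζ).le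
  have h := (hasSum_choose_mul_geometric_of_norm_lt_one (α + 1) hx).mul_left (α + 1 : ℂ)
  rw [kernelSeries, div_eq_mul_one_div, ← h.tsum_eq]
  refine tsum_congr fun n => ?_
  rw [moment_standardWeight, Nat.cast_choose ℂ (by omega : α + 1 ≤ n + (α + 1)),
    Nat.add_sub_cancel, Nat.factorial_succ α, ← add_assoc, mul_pow]
  have h1 := n.factorial_ne_zero
  have h2 := α.factorial_ne_zero
  have h3 : (α + 1 : ℂ) ≠ 0 := by exact_mod_cast α.succ_ne_zero
  push_cast
  field_simp

theorem le_norm_one_sub_conj_mul (z ζ : ℂ) : 1 - ‖ζ‖ * ‖z‖ ≤ ‖1 - conj z * ζ‖ := by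
  have := norm_sub_norm_le 1 (conj z * ζ)
  rwa [norm_one, norm_mul, RCLike.norm_conj, mul_comm] at this

/-- Only `α` of the `α + 2` factors are estimated radially; the remaining square has an exact
circular mean. -/
theorem norm_kernelSeries_standardWeight_le (α : ℕ) {z ζ : ℂ} (hz : z ∈ disc) (hζ : ζ ∈ disc) :
    ‖kernelSeries (standardWeight α) z ζ‖ ≤
      (α + 1) / (1 - ‖ζ‖ * ‖z‖) ^ α * (‖1 - conj z * ζ‖ ^ 2)⁻¹ := by
  have h := le_norm_one_sub_conj_mul z ζ
  have h0 : 0 < 1 - ‖ζ‖ * ‖z‖ := sub_pos.2 (mul_lt_one_of_nonneg_of_lt_one_left (norm_nonneg _)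
    (mem_disc.1 hζ) (mem_disc.1 hz).le)
  have hα : ‖(α + 1 : ℂ)‖ = α + 1 := by
    rw [← Nat.cast_one, ← Nat.cast_add, Complex.norm_natCast]
    push_cast
    rfl
  rw [kernelSeries_standardWeight α hz hζ, norm_div, norm_pow, hα, pow_add, ← div_div,
    div_eq_mul_inv (_ / _) (‖1 - conj z * ζ‖ ^ 2)]
  gcongr

/-- On `|ζ| = s`, `s |1 - conj z ζ| = |ζ - s² z|`, so the integrand is a multiple of the Poisson
kernel at `w = s² z`, whose mean is 1. -/
theorem circleAverage_inv_norm_one_sub_sq {z : ℂ} (hz : z ∈ disc) {s : ℝ} (h0 : 0 < s)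
    (h1 : s < 1) :
    Real.circleAverage (fun ζ => (((‖1 - conj z * ζ‖ ^ 2)⁻¹ : ℝ) : ℂ)) 0 s =
      (((1 - (s * ‖z‖) ^ 2)⁻¹ : ℝ) : ℂ) := by
  have hz1 := mem_disc.1 hz
  set w : ℂ := (s ^ 2 : ℝ) * z with hw
  have hwn : ‖w‖ = s ^ 2 * ‖z‖ := by
    rw [hw, norm_mul, Complex.norm_real, Real.norm_of_nonneg (by positivity)]
  have hwm : w ∈ Metric.ball (0 : ℂ) s := by
    rw [mem_ball_zero_iff, hwn]
    nlinarith [norm_nonneg z]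
  have hP := (diffContOnCl_const (c := ((((1 - (s * ‖z‖) ^ 2)⁻¹ : ℝ) : ℂ)))
    (s := Metric.ball (0 : ℂ) s) (𝕜 := ℂ)).circleAverage_poissonKernel_smul' hwm
  rw [← hP]
  refine Real.circleAverage_congr_sphere fun ζ hζ => ?_
  have hn : ‖ζ‖ = s := by simpa [abs_of_pos h0] using hζ
  have hc : s * ‖1 - conj z * ζ‖ = ‖ζ - w‖ := by
    have : conj ζ * (ζ - w) = (s ^ 2 : ℝ) * conj (1 - conj z * ζ) := by
      have h2 : conj ζ * ζ = (s ^ 2 : ℝ) := by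
        rw [mul_comm, Complex.mul_conj, Complex.normSq_eq_norm_sq, hn]
      simp only [map_sub, map_mul, map_one, Complex.conj_conj]
      rw [mul_sub, h2, hw]
      ring
    have h3 := congrArg norm this
    rw [norm_mul, norm_mul, RCLike.norm_conj, RCLike.norm_conj, hn, Complex.norm_real,
      Real.norm_of_nonneg (by positivity), pow_two, mul_assoc] at h3
    exact (mul_left_cancel₀ h0.ne' h3).symm
  have hpos : 0 < 1 - (s * ‖z‖) ^ 2 := by
    have : s * ‖z‖ < 1 := mul_lt_one_of_nonneg_of_lt_one_left h0.le h1 hz1.le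
    have : 0 ≤ s * ‖z‖ := by positivity
    nlinarith
  simp only [sub_zero, hn, hwn, ← hc, Complex.real_smul, ← Complex.ofReal_mul]
  congr 1
  rw [mul_pow s ‖1 - _‖]
  have e : s ^ 2 - (s ^ 2 * ‖z‖) ^ 2 = s ^ 2 * (1 - (s * ‖z‖) ^ 2) := by ring
  rw [e]
  generalize 1 - (s * ‖z‖) ^ 2 = X at hpos
  field_simp

/-- Since `|f| ≤ ‖f‖/ν̂` almost everywhere, it suffices to test the positive operator with kernel
`|B_z| ω` on `1/ν̂`. -/
theorem projectionBounded_of_integral_le (hω : IsRadialWeight ω) (hν : IsRadialWeight ν)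
    (hint : Integrable (fun ζ : ℂ => ω ‖ζ‖ / tail ν ‖ζ‖) areaMeasure) {A : ℝ} (hA : 0 ≤ A)
    (h : ∀ z ∈ disc, ∫ ζ, ‖kernelSeries ω z ζ‖ * (ω ‖ζ‖ / tail ν ‖ζ‖) ∂areaMeasure ≤
      A / tail ν ‖z‖) :
    ProjectionBounded ω (tail ν) := by
  have hdom : ∀ f : ℂ → ℂ, MemGrowth (tail ν) f → ∀ᵐ ζ ∂areaMeasure,
      ‖f ζ‖ ≤ (growthNorm (tail ν) f).toReal / tail ν ‖ζ‖ := fun f hf => by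
    filter_upwards [ae_norm_mul_le_growthNorm hf.2,
      ae_areaMeasure_of_forall fun z hz => hν.tail_norm_pos hz] with ζ h1 h2
    rwa [le_div_iff₀ h2]
  have hwn : ∀ᵐ ζ ∂areaMeasure, 0 ≤ ω ‖ζ‖ := ae_areaMeasure_of_forall fun z hz => hω.nonneg_norm hz
  have hfω : ∀ f : ℂ → ℂ, MemGrowth (tail ν) f →
      Integrable (fun ζ => f ζ * (ω ‖ζ‖ : ℂ)) areaMeasure := fun f hf => by
    refine Integrable.mono' (hint.const_mul (growthNorm (tail ν) f).toReal)
      (hf.1.mul hω.integrable_norm.ofReal.aestronglyMeasurable) ?_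
    filter_upwards [hdom f hf, hwn] with ζ h1 h2
    rw [norm_mul, Complex.norm_real, Real.norm_of_nonneg h2]
    calc ‖f ζ‖ * ω ‖ζ‖ ≤ (growthNorm (tail ν) f).toReal / tail ν ‖ζ‖ * ω ‖ζ‖ := by gcongr
      _ = _ := by ring
  refine ⟨fun f hf z hz => (integrable_mul_bergmanKernel_iff hω f hz).2
    (integrable_mul_conj_kernelSeries hω (hfω f hf) hz), ⟨A, hA⟩, fun f hf => ?_⟩
  have hdiff : DifferentiableOn ℂ (bergmanProjection ω f) disc :=
    (differentiableOn_integral_mul_conj_kernelSeries hω (hfω f hf)).congr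
      fun z hz => bergmanProjection_eq hω f hz
  set N := (growthNorm (tail ν) f).toReal with hN
  have hN0 : 0 ≤ N := ENNReal.toReal_nonneg
  have hb : ∀ z ∈ disc, ‖bergmanProjection ω f z‖ * tail ν ‖z‖ ≤ A * N := fun z hz => by
    have ht := hν.tail_norm_pos hz
    have hKint : Integrable (fun ζ => ‖kernelSeries ω z ζ‖ * (ω ‖ζ‖ / tail ν ‖ζ‖)) areaMeasure :=
      Integrable.bdd_mul (c := ∑' n : ℕ, ‖z‖ ^ n / moment ω n) hint
        (aestronglyMeasurable_of_continuousOn_disc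
          (differentiableOn_kernelSeries hω hz).continuousOn).norm
        (ae_areaMeasure_of_forall fun ζ hζ => by
          rw [norm_norm]
          exact norm_kernelSeries_le hω hz hζ)
    rw [← le_div_iff₀ ht, bergmanProjection_eq hω f hz]
    calc ‖∫ ζ, f ζ * conj (kernelSeries ω z ζ) * (ω ‖ζ‖ : ℂ) ∂areaMeasure‖
        ≤ ∫ ζ, N * (‖kernelSeries ω z ζ‖ * (ω ‖ζ‖ / tail ν ‖ζ‖)) ∂areaMeasure := by
          refine norm_integral_le_of_norm_le (hKint.const_mul N) ?_
          filter_upwards [hdom f hf, hwn] with ζ h1 h2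
          rw [norm_mul, norm_mul, RCLike.norm_conj, Complex.norm_real, Real.norm_of_nonneg h2]
          calc ‖f ζ‖ * ‖kernelSeries ω z ζ‖ * ω ‖ζ‖
              ≤ N / tail ν ‖ζ‖ * ‖kernelSeries ω z ζ‖ * ω ‖ζ‖ := by gcongr
            _ = _ := by ring
      _ ≤ N * (A / tail ν ‖z‖) := by
          rw [integral_const_mul]
          gcongr
          exact h z hz
      _ = A * N / tail ν ‖z‖ := by ring
  have hle := growthNorm_le_ofReal (ae_areaMeasure_of_forall hb)
  refine ⟨⟨⟨aestronglyMeasurable_of_continuousOn_disc hdiff.continuousOn,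
    hle.trans_lt ENNReal.ofReal_lt_top⟩, hdiff⟩, hle.trans ?_⟩
  rw [ENNReal.ofReal_mul hA, hN, ENNReal.ofReal_toReal hf.2.ne]
  gcongr
  exact (ENNReal.ofReal_eq_coe_nnreal hA).le

theorem one_sub_mul_norm_pos {z : ℂ} (hz : z ∈ disc) {s : ℝ} (h0 : 0 ≤ s) (h1 : s < 1) :
    0 < 1 - s * ‖z‖ :=
  sub_pos.2 (mul_lt_one_of_nonneg_of_lt_one_left h0 h1 (mem_disc.1 hz).le)

theorem integral_norm_kernelSeries_standardWeight_le (hν : IsRadialWeight ν) (α : ℕ)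
    (hint : Integrable (fun ζ : ℂ => standardWeight α ‖ζ‖ / tail ν ‖ζ‖) areaMeasure) {z : ℂ}
    (hz : z ∈ disc) :
    ∫ ζ, ‖kernelSeries (standardWeight α) z ζ‖ * (standardWeight α ‖ζ‖ / tail ν ‖ζ‖) ∂areaMeasure ≤
      ∫ s in Ioo (0 : ℝ) 1, 2 * s * ((α + 1) / (1 - s * ‖z‖) ^ α *
        (standardWeight α s / tail ν s) * (1 - (s * ‖z‖) ^ 2)⁻¹) := by
  have hz1 := mem_disc.1 hz
  have hr : 0 < 1 - ‖z‖ := by linarith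
  set H : ℝ → ℝ := fun s => (α + 1) / (1 - s * ‖z‖) ^ α * (standardWeight α s / tail ν s) with hH
  have hnorm : ∀ ζ ∈ disc, 0 < 1 - ‖ζ‖ * ‖z‖ := fun ζ hζ =>
    one_sub_mul_norm_pos hz (norm_nonneg _) (mem_disc.1 hζ)
  have hnorm' : ∀ ζ ∈ disc, 0 < ‖1 - conj z * ζ‖ := fun ζ hζ =>
    (hnorm ζ hζ).trans_le (le_norm_one_sub_conj_mul z ζ)
  have hle : ∀ ζ ∈ disc, 1 - ‖z‖ ≤ 1 - ‖ζ‖ * ‖z‖ := fun ζ hζ => by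
    have := mul_le_of_le_one_left (norm_nonneg z) (mem_disc.1 hζ).le
    linarith
  have hG : Integrable (fun ζ : ℂ => H ‖ζ‖ * (‖1 - conj z * ζ‖ ^ 2)⁻¹) areaMeasure := by
    refine (Integrable.bdd_mul (c := (α + 1) / (1 - ‖z‖) ^ α * ((1 - ‖z‖) ^ 2)⁻¹) hint
      (f := fun ζ : ℂ => (α + 1) / (1 - ‖ζ‖ * ‖z‖) ^ α * (‖1 - conj z * ζ‖ ^ 2)⁻¹) ?_ ?_).congr
      (ae_of_all _ fun ζ => by simp only [hH]; ring)
    · rw [aestronglyMeasurable_areaMeasure_iff]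
      refine ContinuousOn.aestronglyMeasurable ?_ measurableSet_disc
      refine ContinuousOn.mul (ContinuousOn.div (by fun_prop) (by fun_prop) fun ζ hζ =>
        (pow_pos (hnorm ζ hζ) _).ne') (ContinuousOn.inv₀ (by fun_prop) fun ζ hζ =>
        (pow_pos (hnorm' ζ hζ) _).ne')
    · refine ae_areaMeasure_of_forall fun ζ hζ => ?_
      have h1 := hnorm ζ hζ
      have h2 := hnorm' ζ hζ
      have h3 := hle ζ hζ
      have h4 := h3.trans (le_norm_one_sub_conj_mul z ζ)
      rw [Real.norm_of_nonneg (by positivity)]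
      gcongr
  have hmono : ∫ ζ, ‖kernelSeries (standardWeight α) z ζ‖ *
      (standardWeight α ‖ζ‖ / tail ν ‖ζ‖) ∂areaMeasure ≤
      ∫ ζ : ℂ, H ‖ζ‖ * (‖1 - conj z * ζ‖ ^ 2)⁻¹ ∂areaMeasure := by
    refine integral_mono_of_nonneg (ae_areaMeasure_of_forall fun ζ hζ => ?_) hG
      (ae_areaMeasure_of_forall fun ζ hζ => ?_)
    · have h1 := hν.tail_norm_pos hζ
      have h2 := standardWeight_pos α (norm_nonneg ζ) (mem_disc.1 hζ)
      simp only [Pi.zero_apply]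
      positivity
    · have h1 := hν.tail_norm_pos hζ
      have h2 := standardWeight_pos α (norm_nonneg ζ) (mem_disc.1 hζ)
      calc ‖kernelSeries (standardWeight α) z ζ‖ * (standardWeight α ‖ζ‖ / tail ν ‖ζ‖)
          ≤ (α + 1) / (1 - ‖ζ‖ * ‖z‖) ^ α * (‖1 - conj z * ζ‖ ^ 2)⁻¹ *
            (standardWeight α ‖ζ‖ / tail ν ‖ζ‖) := by
            gcongr
            exact norm_kernelSeries_standardWeight_le α hz hζ
        _ = H ‖ζ‖ * (‖1 - conj z * ζ‖ ^ 2)⁻¹ := by simp only [hH]; ring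
  refine hmono.trans (le_of_eq ?_)
  have h := integral_areaMeasure_circleAverage (hG.ofReal (𝕜 := ℂ))
  rw [← Complex.ofReal_inj]
  refine (integral_complex_ofReal.symm.trans h).trans ?_
  rw [← integral_complex_ofReal]
  refine setIntegral_congr_fun measurableSet_Ioo fun s hs => ?_
  have hc : Real.circleAverage (fun ζ : ℂ => ((H ‖ζ‖ * (‖1 - conj z * ζ‖ ^ 2)⁻¹ : ℝ) : ℂ)) 0 s =
      Real.circleAverage (fun ζ : ℂ => (H s) • (((‖1 - conj z * ζ‖ ^ 2)⁻¹ : ℝ) : ℂ)) 0 s := by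
    refine Real.circleAverage_congr_sphere fun ζ hζ => ?_
    have hn : ‖ζ‖ = s := by simpa [abs_of_pos hs.1] using hζ
    simp only [hn, Complex.real_smul, Complex.ofReal_mul]
  refine (congrArg ((2 * s) • ·) hc).trans ?_
  rw [Real.circleAverage_fun_smul, circleAverage_inv_norm_one_sub_sq hz hs.1 hs.2]
  simp only [Complex.real_smul, ← Complex.ofReal_mul, hH]

/-- The Bergman projection induced by a standard weight of large exponent is bounded on the growth
space of a weight that is both upper and lower doubling. -/
theorem exists_projectionBounded (hν : IsRadialWeight ν) (hD : UpperDoubling ν)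
    (hL : LowerDoubling ν) :
    ∃ ω : ℝ → ℝ, IsRadialWeight ω ∧ ProjectionBounded ω (tail ν) := by
  obtain ⟨α, C, hC0, hC⟩ := hD.exists_pow_mul_tail_le hν
  obtain ⟨A, hA0, hA⟩ := hL.exists_integral_inv_le hν
  have hω := isRadialWeight_standardWeight α
  have hv0 := hν.tail_pos 0 ⟨le_rfl, one_pos⟩
  have hquot : ∀ r s, 0 ≤ r → r ≤ s → s < 1 →
      (1 - s) ^ α / tail ν s ≤ C * (1 - r) ^ α / tail ν r := fun r s h0 h1 h2 => by
    rw [div_le_div_iff₀ (hν.tail_pos s ⟨h0.trans h1, h2⟩) (hν.tail_pos r ⟨h0, h1.trans_lt h2⟩)]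
    exact hC r s h0 h1 h2
  have hint : Integrable (fun ζ : ℂ => standardWeight α ‖ζ‖ / tail ν ‖ζ‖) areaMeasure := by
    refine Integrable.of_bound (aestronglyMeasurable_areaMeasure_iff.2
      (ContinuousOn.aestronglyMeasurable (((continuous_standardWeight α).comp
        continuous_norm).continuousOn.div hν.continuousOn_tail_norm fun z hz =>
          (hν.tail_norm_pos hz).ne') measurableSet_disc)) (2 ^ α * (C / tail ν 0))
      (ae_areaMeasure_of_forall fun ζ hζ => ?_)
    have h1 := hν.tail_norm_pos hζ
    have h2 := standardWeight_pos α (norm_nonneg ζ) (mem_disc.1 hζ)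
    have h3 := hquot 0 ‖ζ‖ le_rfl (norm_nonneg _) (mem_disc.1 hζ)
    rw [sub_zero, one_pow, mul_one] at h3
    rw [Real.norm_of_nonneg (by positivity)]
    calc standardWeight α ‖ζ‖ / tail ν ‖ζ‖ ≤ 2 ^ α * (1 - ‖ζ‖) ^ α / tail ν ‖ζ‖ := by
          gcongr
          exact standardWeight_le α (norm_nonneg ζ) (mem_disc.1 hζ)
      _ = 2 ^ α * ((1 - ‖ζ‖) ^ α / tail ν ‖ζ‖) := by ring
      _ ≤ _ := by gcongr
  -- The factors come from the polar measure `2s ds`, the kernel constant `α + 1`, and `1 - s² ≤ 2(1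
  -- - s)`.
  set E : ℝ := 2 * (α + 1) * 2 ^ α with hE
  have hE0 : 0 < E := by positivity
  refine ⟨standardWeight α, hω, projectionBounded_of_integral_le hω hν hint
    (A := E * (A + C)) (by positivity) fun z hz => ?_⟩
  refine (integral_norm_kernelSeries_standardWeight_le hν α hint hz).trans ?_
  set r := ‖z‖ with hr
  have hr0 : 0 ≤ r := norm_nonneg z
  have hr1 : r < 1 := mem_disc.1 hz
  have hr1' : 0 < 1 - r := by linarith
  have htr := hν.tail_pos r ⟨hr0, hr1⟩
  set g₁ : ℝ → ℝ := fun s => ((1 - s) * tail ν s)⁻¹ with hg₁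
  set c : ℝ := C / ((1 - r) * tail ν r) with hc
  have hg₁int : IntegrableOn g₁ (Ioc 0 r) :=
    (intervalIntegrable_iff_integrableOn_Ioc_of_le hr0).1
      (hν.intervalIntegrable_inv le_rfl hr0 hr1)
  have hi1 : Integrable ((Ioc 0 r).indicator g₁) := hg₁int.integrable_indicator measurableSet_Ioc
  have hi2 : Integrable ((Ioo r 1).indicator fun _ : ℝ => c) :=
    (integrableOn_const (by simp)).integrable_indicator measurableSet_Ioo
  have hg : Integrable fun s => E * ((Ioc 0 r).indicator g₁ s + (Ioo r 1).indicator (fun _ => c) s) :=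
    (hi1.add hi2).const_mul E
  have hpt : ∀ s ∈ Ioo (0 : ℝ) 1, 2 * s * ((α + 1) / (1 - s * r) ^ α *
      (standardWeight α s / tail ν s) * (1 - (s * r) ^ 2)⁻¹) ≤
      E * ((Ioc 0 r).indicator g₁ s + (Ioo r 1).indicator (fun _ => c) s) := by
    intro s hs
    have hs0 := hs.1
    have hs1 : 0 < 1 - s := sub_pos.2 hs.2
    have hts := hν.tail_pos s ⟨hs.1.le, hs.2⟩
    have h1 : 0 < 1 - s * r := one_sub_mul_norm_pos hz hs.1.le hs.2
    have h2 : 1 - s * r ≤ 1 - (s * r) ^ 2 := by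
      have : 0 ≤ s * r := by positivity
      nlinarith
    have h3 := standardWeight_le α hs.1.le hs.2
    have h4 := standardWeight_pos α hs.1.le hs.2
    have h5 : 2 * s * ((α + 1) / (1 - s * r) ^ α * (standardWeight α s / tail ν s) *
        (1 - (s * r) ^ 2)⁻¹) ≤ E * ((1 - s) ^ α / tail ν s * ((1 - s * r) ^ (α + 1))⁻¹) := by
      calc 2 * s * ((α + 1) / (1 - s * r) ^ α * (standardWeight α s / tail ν s) *
            (1 - (s * r) ^ 2)⁻¹)
          ≤ 2 * 1 * ((α + 1) / (1 - s * r) ^ α * (2 ^ α * (1 - s) ^ α / tail ν s) *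
            (1 - s * r)⁻¹) := by
            have : 0 < 1 - (s * r) ^ 2 := h1.trans_le h2
            gcongr
            exact hs.2.le
        _ = _ := by
            rw [hE, pow_succ]
            field_simp
    refine h5.trans (mul_le_mul_of_nonneg_left ?_ hE0.le)
    -- For `s ≤ r` use `1 - sr ≥ 1 - s`, leaving the integrand of the lower doubling estimate; for
    -- `s > r` use `1 - sr ≥ 1 - r` and the almost monotone quotient `hquot`, leaving the constant
    -- `c`.
    rcases le_or_gt s r with hsr | hsr
    · rw [indicator_of_mem (show s ∈ Ioc 0 r from ⟨hs0, hsr⟩),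
        indicator_of_notMem (fun h : s ∈ Ioo r 1 => absurd h.1 (not_lt.2 hsr)), add_zero]
      have h6 : 1 - s ≤ 1 - s * r := by nlinarith
      calc (1 - s) ^ α / tail ν s * ((1 - s * r) ^ (α + 1))⁻¹
          ≤ (1 - s) ^ α / tail ν s * ((1 - s) ^ (α + 1))⁻¹ := by gcongr
        _ = g₁ s := by
            rw [hg₁, pow_succ]
            field_simp
    · rw [indicator_of_notMem (fun h : s ∈ Ioc 0 r => absurd h.2 (not_le.2 hsr)),
        indicator_of_mem (show s ∈ Ioo r 1 from ⟨hsr, hs.2⟩), zero_add]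
      have h6 : 1 - r ≤ 1 - s * r := by nlinarith
      calc (1 - s) ^ α / tail ν s * ((1 - s * r) ^ (α + 1))⁻¹
          ≤ C * (1 - r) ^ α / tail ν r * ((1 - r) ^ (α + 1))⁻¹ := by
            refine mul_le_mul (hquot r s hr0 hsr.le hs.2) ?_ (by positivity) (by positivity)
            gcongr
        _ = c := by
            rw [hc, pow_succ]
            field_simp
  have hsub1 : Ioo (0 : ℝ) 1 ∩ Ioc 0 r = Ioc 0 r :=
    inter_eq_right.2 fun s hs => ⟨hs.1, hs.2.trans_lt hr1⟩
  have hsub2 : Ioo (0 : ℝ) 1 ∩ Ioo r 1 = Ioo r 1 :=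
    inter_eq_right.2 fun s hs => ⟨hr0.trans_lt hs.1, hs.2⟩
  calc ∫ s in Ioo (0 : ℝ) 1, 2 * s * ((α + 1) / (1 - s * r) ^ α *
        (standardWeight α s / tail ν s) * (1 - (s * r) ^ 2)⁻¹)
      ≤ ∫ s in Ioo (0 : ℝ) 1,
          E * ((Ioc 0 r).indicator g₁ s + (Ioo r 1).indicator (fun _ => c) s) := by
        refine integral_mono_of_nonneg ((ae_restrict_iff' measurableSet_Ioo).2
          (ae_of_all _ fun s hs => ?_)) hg.integrableOn
          ((ae_restrict_iff' measurableSet_Ioo).2 (ae_of_all _ hpt))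
        have hs0 := hs.1
        have hts := hν.tail_pos s ⟨hs.1.le, hs.2⟩
        have h1 : 0 < 1 - s * r := one_sub_mul_norm_pos hz hs.1.le hs.2
        have h2 : 0 < 1 - (s * r) ^ 2 := by
          have : 0 ≤ s * r := by positivity
          nlinarith
        have h4 := standardWeight_pos α hs.1.le hs.2
        simp only [Pi.zero_apply]
        positivity
    _ = E * ((∫ s in (0 : ℝ)..r, g₁ s) + (1 - r) * c) := by
        rw [integral_const_mul, integral_add hi1.integrableOn hi2.integrableOn,
          setIntegral_indicator measurableSet_Ioc, setIntegral_indicator measurableSet_Ioo,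
          hsub1, hsub2, setIntegral_const, intervalIntegral.integral_of_le hr0, smul_eq_mul,
          Real.volume_real_Ioo_of_le hr1.le]
    _ ≤ E * (A / tail ν r + (1 - r) * c) := by
        gcongr
        exact hA r hr0 hr1
    _ = E * (A + C) / tail ν r := by
        rw [hc]
        field_simp

end RadialBergman

end

theorem mainTheorem7 (ν : ℝ → ℝ) (hν : RadialBergman.IsRadialWeight ν)
    (hD : RadialBergman.UpperDoubling ν) :
    ((∃ ω : ℝ → ℝ, RadialBergman.IsRadialWeight ω ∧
        RadialBergman.ProjectionBounded ω (RadialBergman.tail ν)) ↔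
      RadialBergman.LowerDoubling ν) ∧
    (¬ RadialBergman.LowerDoubling ν →
      ∀ ω : ℝ → ℝ, RadialBergman.IsRadialWeight ω →
        ¬ RadialBergman.ProjectionBounded ω (RadialBergman.tail ν)) :=
  ⟨⟨fun ⟨_, hω, hP⟩ => hP.lowerDoubling hω hν hD,
    fun hL => RadialBergman.exists_projectionBounded hν hD hL⟩,
    fun hL _ hω hP => hL (hP.lowerDoubling hω hν hD)⟩
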